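/- Write $\Lambda^2$ and $\mathsf{SP}^2$ for the exterior and symmetric square of abelian groups, and let $L_1\mathsf{SP}^2$ be the first derived functor (at level $0$) of the non-additive functor $\mathsf{SP}^2$ in the sense of Dold and Puppe: $L_1\mathsf{SP}^2(A)=H_1\big(\mathsf{SP}^2(K(P_\bullet))\big)$, where $P_\bullet\to A$ is a projective resolution and $K(P_\bullet)$ is the simplicial abelian group corresponding to $P_\bullet$ under the Dold–Kan correspondence. **Theorem 3.1.** Let $E$ be an abelian group and $I$ a subgroup of $E$. Consider the Koszul-type complex $$ \Lambda^2(I)\xrightarrow{\;x\wedge y\,\mapsto\, x\otimes y-y\otimes x\;} I\otimes E\xrightarrow{\;x\otimes e\,\mapsto\, xe\;} \mathsf{SP}^2(E). $$ Its first homology, i.e. its homology at the middle term $I\otimes E$, is isomorphic to $$ \operatorname{Coker}\{L_1\mathsf{SP}^2(E)\to L_1\mathsf{SP}^2(E/I)\}, $$ where the map is induced by the projection $E\to E/I$. The isomorphism is natural in the pair $(E,I)$, that is, with respect to homomorphisms $f\colon E\to E'$ of abelian groups with $f(I)\subseteq I'$. -/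

import Mathlib

open CategoryTheory

open scoped TensorProduct

universe u

noncomputable section

/-! Abelian groups are treated as `ℤ`-modules. The definitions are written for modules over a
commutative ring `R`, and are used for `R = ℤ`. -/

/-! ### The symmetric square -/

section SymmetricSquare

variable {R : Type} [CommRing R]

/-- The map `Symⁿ M → Symⁿ N` induced by a homomorphism `f : M → N`; on products it sends
`m₁ ⋯ mₙ` to `f m₁ ⋯ f mₙ`. -/
def symPowerMap (n : ℕ) {M N : Type u} [AddCommGroup M] [Module R M] [AddCommGroup N]
    [Module R N] (f : M →ₗ[R] N) :
    SymmetricPower R (Fin n) M →ₗ[R] SymmetricPower R (Fin n) N where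
  toFun := AddCon.lift (addConGen (SymmetricPower.Rel R (Fin n) M))
    ((SymmetricPower.mk R (Fin n) N ∘ₗ PiTensorProduct.map (fun _ => f)).toAddMonoidHom) (by
      refine AddCon.addConGen_le.2 ?_
      intro x y h
      cases h with
      | perm e v =>
        rw [AddCon.ker_rel]
        simp only [LinearMap.toAddMonoidHom_coe, LinearMap.comp_apply, PiTensorProduct.map_tprod]
        exact (SymmetricPower.tprod_equiv (R := R) e (fun i => f (v i))).symm)
  map_add' := map_add _
  map_smul' := fun r x => AddCon.induction_on x fun y =>
    (SymmetricPower.mk R (Fin n) N ∘ₗ PiTensorProduct.map (fun _ => f)).map_smul r y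

theorem symPowerMap_tprod (n : ℕ) {M N : Type u} [AddCommGroup M] [Module R M] [AddCommGroup N]
    [Module R N] (f : M →ₗ[R] N) (v : Fin n → M) :
    symPowerMap n f (SymmetricPower.tprod R v) = SymmetricPower.tprod R (fun i => f (v i)) := by
  change SymmetricPower.mk R (Fin n) N
    (PiTensorProduct.map (fun _ => f) (PiTensorProduct.tprod R v)) = _
  rw [PiTensorProduct.map_tprod]
  rfl

theorem symPower_hom_ext {n : ℕ} {M N : Type u} [AddCommGroup M] [Module R M] [AddCommGroup N]
    [Module R N] {f g : SymmetricPower R (Fin n) M →ₗ[R] N}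
    (h : ∀ v : Fin n → M, f (SymmetricPower.tprod R v) = g (SymmetricPower.tprod R v)) :
    f = g :=
  LinearMap.ext_on_range (SymmetricPower.span_tprod_eq_top R (Fin n) M) h

variable (R) in
/-- The symmetric square `SP²` as an endofunctor of the category of `R`-modules. -/
def SP2 : ModuleCat.{u} R ⥤ ModuleCat.{u} R where
  obj A := ModuleCat.of R (SymmetricPower R (Fin 2) A)
  map f := ModuleCat.ofHom (symPowerMap 2 f.hom)
  map_id A := by
    ext1
    exact symPower_hom_ext fun v => symPowerMap_tprod 2 _ v
  map_comp f g := by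
    ext1
    refine symPower_hom_ext fun v => ?_
    simp [symPowerMap_tprod]

end SymmetricSquare

/-! ### Derived functors of non-additive functors (Dold–Puppe)

For `T` from abelian groups to abelian groups, `(Lₙ T)(A)` is the `n`-th homology (homotopy) group
of the simplicial abelian group `T (K (P))`, where `P` is a projective resolution of `A` and `K` is
the inverse of the normalization functor in the Dold–Kan correspondence. We use the
functorial free resolution `⋯ → 0 → ker (ℤ[A] → A) → ℤ[A]` of `A`. -/

section FreeResolution

variable {R : Type} [CommRing R]

/-- The canonical surjection `R[A] → A` from the free module on the set `A`. -/
def freeCover (A : ModuleCat.{u} R) : (A →₀ R) →ₗ[R] A :=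
  Finsupp.linearCombination R id

theorem freeCover_surjective (A : ModuleCat.{u} R) : Function.Surjective (freeCover A) :=
  fun a => ⟨Finsupp.single a 1, by simp [freeCover]⟩

theorem freeCover_naturality {A B : ModuleCat.{u} R} (f : A ⟶ B) (x : A →₀ R) :
    freeCover B (Finsupp.lmapDomain R R f x) = f (freeCover A x) := by
  change Finsupp.linearCombination R id (Finsupp.mapDomain f x) =
    f.hom (Finsupp.linearCombination R id x)
  rw [Finsupp.linearCombination_mapDomain, Finsupp.apply_linearCombination]
  rfl

/-- The terms `R[A]`, `ker (R[A] → A)`, `0`, `0`, … of the canonical resolution of `A`. -/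
abbrev freeResolutionX (A : ModuleCat.{u} R) : ℕ → ModuleCat.{u} R
  | 0 => ModuleCat.of R (A →₀ R)
  | 1 => ModuleCat.of R (LinearMap.ker (freeCover A))
  | _ + 2 => ModuleCat.of R PUnit

/-- The differentials of the canonical resolution of `A`. -/
def freeResolutionD (A : ModuleCat.{u} R) :
    ∀ n, freeResolutionX A (n + 1) ⟶ freeResolutionX A n
  | 0 => ModuleCat.ofHom (LinearMap.ker (freeCover A)).subtype
  | _ + 1 => 0

/-- The map induced by `f : A → B` on the terms of the canonical resolutions. -/
def freeResolutionMap {A B : ModuleCat.{u} R} (f : A ⟶ B) :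
    ∀ n, freeResolutionX A n ⟶ freeResolutionX B n
  | 0 => ModuleCat.ofHom (Finsupp.lmapDomain R R f)
  | 1 => ModuleCat.ofHom ((Finsupp.lmapDomain R R f).restrict (fun x hx => by
      rw [LinearMap.mem_ker] at hx ⊢
      rw [freeCover_naturality, hx, map_zero]))
  | _ + 2 => 0

theorem freeResolutionD_comp (A : ModuleCat.{u} R) (n : ℕ) :
    freeResolutionD A (n + 1) ≫ freeResolutionD A n = 0 :=
  Limits.zero_comp

theorem freeResolutionMap_comm {A B : ModuleCat.{u} R} (f : A ⟶ B) :
    ∀ n, freeResolutionMap f (n + 1) ≫ freeResolutionD B n =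
      freeResolutionD A n ≫ freeResolutionMap f n
  | 0 => rfl
  | _ + 1 => Limits.zero_comp.trans Limits.zero_comp.symm

variable (R) in
/-- The canonical resolution `⋯ → 0 → ker (R[A] → A) → R[A]` of `A`, as a functor of `A`.
For `R = ℤ` it is a free resolution: a subgroup of a free abelian group is free. -/
def freeResolution : ModuleCat.{u} R ⥤ ChainComplex (ModuleCat.{u} R) ℕ where
  obj A := ChainComplex.of (freeResolutionX A) (freeResolutionD A) (freeResolutionD_comp A)
  map {A B} f := ChainComplex.ofHom (freeResolutionMap f) (fun n => by
    change _ ≫ ChainComplex.of.d (freeResolutionX B) (freeResolutionD B) (n + 1) n =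
      ChainComplex.of.d (freeResolutionX A) (freeResolutionD A) (n + 1) n ≫ _
    rw [ChainComplex.of_d, ChainComplex.of_d]
    exact freeResolutionMap_comm f n)
  map_id A := by
    ext n : 1
    match n with
    | 0 => exact ModuleCat.hom_ext (Finsupp.lmapDomain_id R R)
    | 1 =>
      exact ModuleCat.hom_ext (LinearMap.ext fun x =>
        Subtype.ext (LinearMap.congr_fun (Finsupp.lmapDomain_id R R) x.1))
    | n + 2 => exact ModuleCat.hom_ext (LinearMap.ext fun x => rfl)
  map_comp f g := by
    ext n : 1
    match n with
    | 0 => exact ModuleCat.hom_ext (Finsupp.lmapDomain_comp R R f g)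
    | 1 =>
      exact ModuleCat.hom_ext (LinearMap.ext fun x =>
        Subtype.ext (LinearMap.congr_fun (Finsupp.lmapDomain_comp R R f g) x.1))
    | n + 2 => exact ModuleCat.hom_ext (LinearMap.ext fun x => rfl)

end FreeResolution

/-- The `n`-th derived functor `Lₙ T` (at level `0`) of a not necessarily additive functor `T`
from abelian groups to abelian groups, in the sense of Dold and Puppe. -/
def doldPuppeDerived (T : ModuleCat.{u} ℤ ⥤ ModuleCat.{u} ℤ) (n : ℕ) :
    ModuleCat.{u} ℤ ⥤ ModuleCat.{u} ℤ :=
  freeResolution ℤ ⋙ Abelian.DoldKan.Γ ⋙ (SimplicialObject.whiskering _ _).obj T ⋙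
    AlgebraicTopology.alternatingFaceMapComplex (ModuleCat.{u} ℤ) ⋙
    HomologicalComplex.homologyFunctor _ _ n

/-- The functor `L₁SP²` on abelian groups. -/
def L1SP2 : ModuleCat.{u} ℤ ⥤ ModuleCat.{u} ℤ :=
  doldPuppeDerived (SP2 ℤ) 1

/-! ### The Koszul-type complex `Λ²(I) → I ⊗ E → SP²(E)` -/

theorem update_zero_fin_two {α : Type*} (a b c : α) : Function.update ![a, b] 0 c = ![c, b] := by
  funext i
  fin_cases i <;> simp

theorem update_one_fin_two {α : Type*} (a b c : α) : Function.update ![a, b] 1 c = ![a, c] := by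
  funext i
  fin_cases i <;> simp

section Koszul

variable {R : Type} [CommRing R] (E : Type u) [AddCommGroup E] [Module R E] (I : Submodule R E)

/-- The map `Λ²(I) → I ⊗ E`, `x ∧ y ↦ x ⊗ y - y ⊗ x`. -/
def koszulTwo : ⋀[R]^2 I →ₗ[R] I ⊗[R] E :=
  exteriorPower.alternatingMapLinearEquiv
    { toFun := fun v => v 0 ⊗ₜ[R] (v 1 : E) - v 1 ⊗ₜ[R] (v 0 : E)
      map_update_add' := fun v i x y => by
        fin_cases i <;>
          simp [Function.update, TensorProduct.add_tmul, TensorProduct.tmul_add] <;> abel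
      map_update_smul' := fun v i c x => by
        fin_cases i <;>
          simp [Function.update, TensorProduct.smul_tmul', smul_sub]
      map_eq_zero_of_eq' := fun v i j h hij => by
        have h01 : v 0 = v 1 := by
          fin_cases i <;> fin_cases j <;> simp_all
        simp [h01] }

theorem koszulTwo_ιMulti (v : Fin 2 → I) :
    koszulTwo E I (exteriorPower.ιMulti R 2 v) =
      v 0 ⊗ₜ[R] (v 1 : E) - v 1 ⊗ₜ[R] (v 0 : E) := by
  rw [koszulTwo, exteriorPower.alternatingMapLinearEquiv_apply_ιMulti]
  rfl

/-- The map `I ⊗ E → SP²(E)`, `x ⊗ y ↦ x y`. -/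
def koszulOne : I ⊗[R] E →ₗ[R] SymmetricPower R (Fin 2) E :=
  TensorProduct.lift
    (LinearMap.mk₂ R (fun (x : I) (y : E) => SymmetricPower.tprod R ![(x : E), y])
      (fun x x' y => by
        have h := (SymmetricPower.tprod R (ι := Fin 2) (M := E)).map_update_add
          ![0, y] 0 (x : E) x'
        simp only [update_zero_fin_two] at h
        exact h)
      (fun c x y => by
        have h := (SymmetricPower.tprod R (ι := Fin 2) (M := E)).map_update_smul
          ![0, y] 0 c (x : E)
        simp only [update_zero_fin_two] at h
        exact h)
      (fun x y y' => by
        have h := (SymmetricPower.tprod R (ι := Fin 2) (M := E)).map_update_add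
          ![(x : E), 0] 1 y y'
        simp only [update_one_fin_two] at h
        exact h)
      (fun c x y => by
        have h := (SymmetricPower.tprod R (ι := Fin 2) (M := E)).map_update_smul
          ![(x : E), 0] 1 c y
        simp only [update_one_fin_two] at h
        exact h))

theorem koszulOne_tmul (x : I) (y : E) :
    koszulOne E I (x ⊗ₜ[R] y) = SymmetricPower.tprod R ![(x : E), y] :=
  rfl

/-- The Koszul-type complex `Λ²(I) → I ⊗ E → SP²(E)`. -/
def koszul : ShortComplex (ModuleCat.{u} R) where
  X₁ := ModuleCat.of R (⋀[R]^2 I)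
  X₂ := ModuleCat.of R (I ⊗[R] E)
  X₃ := (SP2 R).obj (ModuleCat.of R E)
  f := ModuleCat.ofHom (koszulTwo E I)
  g := ModuleCat.ofHom (koszulOne E I)
  zero := by
    ext1
    refine exteriorPower.linearMap_ext ?_
    ext v
    change koszulOne E I (koszulTwo E I (exteriorPower.ιMulti R 2 v)) = 0
    rw [koszulTwo_ιMulti, map_sub, koszulOne_tmul, koszulOne_tmul, sub_eq_zero,
      ← SymmetricPower.tprod_equiv (R := R) (Equiv.swap (0 : Fin 2) 1)]
    congr 1
    funext i
    fin_cases i <;> simp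

variable {E I} {E' : Type u} [AddCommGroup E'] [Module R E'] {I' : Submodule R E'}

/-- The map of Koszul-type complexes induced by `f : E → E'` with `f(I) ⊆ I'`. -/
def koszulMap (f : E →ₗ[R] E') (hf : I ≤ I'.comap f) : koszul E I ⟶ koszul E' I' where
  τ₁ := ModuleCat.ofHom (exteriorPower.map 2 (f.restrict hf))
  τ₂ := ModuleCat.ofHom (TensorProduct.map (f.restrict hf) f)
  τ₃ := (SP2 R).map (ModuleCat.ofHom f)
  comm₁₂ := by
    ext1
    refine exteriorPower.linearMap_ext ?_
    ext v
    change koszulTwo E' I' (exteriorPower.map 2 _ (exteriorPower.ιMulti R 2 v)) =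
      TensorProduct.map _ _ (koszulTwo E I (exteriorPower.ιMulti R 2 v))
    rw [exteriorPower.map_apply_ιMulti, koszulTwo_ιMulti, koszulTwo_ιMulti, map_sub]
    rfl
  comm₂₃ := by
    ext1
    refine TensorProduct.ext' fun x y => ?_
    change koszulOne E' I' (_ ⊗ₜ[R] _) = symPowerMap 2 _ (koszulOne E I (x ⊗ₜ[R] y))
    rw [koszulOne_tmul, koszulOne_tmul, symPowerMap_tprod]
    congr 1
    funext i
    fin_cases i <;> rfl

end Koszul

/-! ### The cokernel of `L₁SP²(E) → L₁SP²(E/I)` -/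

section Cokernel

variable (E : Type u) [AddCommGroup E] (I : Submodule ℤ E)

/-- `Coker {L₁SP²(E) → L₁SP²(E/I)}`, for the map induced by the projection `E → E/I`. -/
def cokerL1SP2 : ModuleCat.{u} ℤ :=
  Limits.cokernel (L1SP2.map (ModuleCat.ofHom I.mkQ))

variable {E I} {E' : Type u} [AddCommGroup E'] {I' : Submodule ℤ E'}

/-- The map of cokernels induced by `f : E → E'` with `f(I) ⊆ I'`. -/
def cokerL1SP2Map (f : E →ₗ[ℤ] E') (hf : I ≤ I'.comap f) : cokerL1SP2 E I ⟶ cokerL1SP2 E' I' :=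
  Limits.cokernel.map _ _ (L1SP2.map (ModuleCat.ofHom f))
    (L1SP2.map (ModuleCat.ofHom (I.mapQ I' f hf))) (by
      rw [← Functor.map_comp, ← Functor.map_comp]
      rfl)

end Cokernel

end

/-!
The isomorphism is obtained from a purely algebraic fact about the Koszul-type complexes
`Kos(I ⊆ E) = (Λ²(I) → I ⊗ E → SP²(E))` and from the computation of `L₁SP²` by such complexes.
Write `H` for the homology in the middle.

*Quotients.* If `p : F → E` is surjective and `S = p⁻¹(I)`, a diagram chase shows that
`H(ker p ⊆ F) → H(S ⊆ F) → H(I ⊆ E) → 0` is exact (`epi_homologyMap_koszulMap`,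
`exists_homologyMap_koszulMap_id_eq`). It needs that the kernel of `SP²(F) → SP²(E)` is the image of
`ker p ⊗ F`, and that the kernel of `S ⊗ F → I ⊗ E` is generated by `ker p ⊗ F` and
`S ⊗ ker p`, where `s ⊗ k` may be replaced by `k ⊗ s` modulo the image of `Λ²(S)`. If `p` splits,
`H(ker p ⊆ F) = 0`, so that `H(S ⊆ F) ≅ H(I ⊆ E)` (`isIso_homologyMap_koszulMap_of_section`).

*Simplicial modules.* Let `X` be a simplicial module with `N₂(X) = 0`, such that
`d₀ : N₁(X) → X₀` is the inclusion `I ⊆ E`. The map `a ⊗ e ↦ a · s₀ e` from `I ⊗ E` to `SP²(X₁)`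
extends to a map of complexes from `Kos(I ⊆ E)` to the alternating face map complex of `SP²(X)`. It
is an isomorphism on `H₁` (`isIso_homologyMap_koszulToSymSquare`). Surjectivity follows from
`X₁ = s₀(X₀) ⊕ N₁(X)`: products of degenerate elements are boundaries, and a product `a b` with
`a, b` in `N₁(X)` is homologous to `s₀(d₀ a) · b`. For injectivity,
`x y ↦ m x ⊗ d₀ y + m y ⊗ d₁ x`, where `m x = x - s₀ d₁ x`, is a well-defined map from `SP²(X₁)` to
`I ⊗ E` modulo the image of `Λ²(I)`; it is a left inverse and vanishes on boundaries
(`exists_koszul_retraction`). By the Dold–Kan correspondence this applies to the canonical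
resolution, hence `L₁SP²(A) ≅ H(ker (ℤ[A] → A) ⊆ ℤ[A])` naturally in `A`.

*Conclusion.* Take `F = ℤ[E] → E`, with kernel `K`, and let `S` be the kernel of `F → E/I`. Then
`H(K ⊆ F) → H(S ⊆ F) → H(I ⊆ E) → 0` is exact, `H(K ⊆ F) ≅ L₁SP²(E)`, and since `ℤ[E] → ℤ[E/I]` is a
split surjection, `H(S ⊆ F) ≅ H(ker (ℤ[E/I] → E/I) ⊆ ℤ[E/I]) ≅ L₁SP²(E/I)`.
-/

noncomputable section

/-! ### Elements of the homology of a short complex of modules -/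

section Homology

variable {R : Type} [CommRing R] {S T U : ShortComplex (ModuleCat.{u} R)}

/-- The homology class of a cycle `x`. -/
def homologyClass (S : ShortComplex (ModuleCat.{u} R)) (x : S.X₂) (hx : S.g x = 0) :
    S.homology :=
  (S.moduleCatCyclesIso.inv ≫ S.homologyπ).hom ⟨x, hx⟩

theorem exists_homologyClass_eq (h : S.homology) : ∃ x hx, homologyClass S x hx = h := by
  obtain ⟨c, rfl⟩ := (ModuleCat.epi_iff_surjective S.homologyπ).1 inferInstance h
  obtain ⟨⟨x, hx⟩, rfl⟩ :=
    (ModuleCat.epi_iff_surjective S.moduleCatCyclesIso.inv).1 inferInstance c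
  exact ⟨x, hx, rfl⟩

theorem homologyClass_eq_zero_iff {x : S.X₂} {hx : S.g x = 0} :
    homologyClass S x hx = 0 ↔ ∃ z, S.f z = x := by
  have h1 : homologyClass S x hx = S.moduleCatHomologyIso.inv
      ((LinearMap.range S.moduleCatToCycles).mkQ ⟨x, hx⟩) :=
    ConcreteCategory.congr_hom S.moduleCatCyclesIso_inv_π ⟨x, hx⟩
  have hinj := (ModuleCat.mono_iff_injective S.moduleCatHomologyIso.inv).1 inferInstance
  rw [h1]
  refine (map_eq_zero_iff S.moduleCatHomologyIso.inv.hom hinj).trans ?_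
  refine (Submodule.Quotient.mk_eq_zero _).trans ?_
  exact exists_congr fun z => Subtype.ext_iff

theorem homologyClass_sub (x y : S.X₂) (hx : S.g x = 0) (hy : S.g y = 0) :
    homologyClass S (x - y) (by rw [map_sub, hx, hy, sub_zero]) =
      homologyClass S x hx - homologyClass S y hy :=
  (S.moduleCatCyclesIso.inv ≫ S.homologyπ).hom.map_sub ⟨x, hx⟩ ⟨y, hy⟩

theorem homologyClass_eq_iff {x y : S.X₂} {hx : S.g x = 0} {hy : S.g y = 0} :
    homologyClass S x hx = homologyClass S y hy ↔ ∃ z, S.f z = x - y := by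
  rw [← sub_eq_zero, ← homologyClass_sub, homologyClass_eq_zero_iff]

theorem g_eq_zero_of_f_eq_sub {x y : S.X₂} {z : S.X₁} (hz : S.f z = x - y) (hy : S.g y = 0) :
    S.g x = 0 := by
  rw [← sub_add_cancel x y, ← hz, map_add, S.moduleCat_zero_apply, hy, add_zero]

theorem comm₂₃_eq_zero (φ : S ⟶ T) {x : S.X₂} (hx : S.g x = 0) : T.g (φ.τ₂ x) = 0 := by
  have h : T.g (φ.τ₂ x) = φ.τ₃ (S.g x) := ConcreteCategory.congr_hom φ.comm₂₃ x
  rw [h, hx, map_zero]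

theorem homologyMap_homologyClass (φ : S ⟶ T) (x : S.X₂) (hx : S.g x = 0) :
    ShortComplex.homologyMap φ (homologyClass S x hx) =
      homologyClass T (φ.τ₂ x) (comm₂₃_eq_zero φ hx) := by
  have h1 : ShortComplex.homologyMap φ (homologyClass S x hx) =
      T.homologyπ (ShortComplex.cyclesMap φ (S.moduleCatCyclesIso.inv ⟨x, hx⟩)) :=
    ConcreteCategory.congr_hom (ShortComplex.homologyπ_naturality φ) _
  rw [h1]
  refine congrArg T.homologyπ ?_
  have hinj := (ModuleCat.mono_iff_injective T.iCycles).1 inferInstance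
  apply hinj
  have h2 : T.iCycles (ShortComplex.cyclesMap φ (S.moduleCatCyclesIso.inv ⟨x, hx⟩)) =
      φ.τ₂ (S.iCycles (S.moduleCatCyclesIso.inv ⟨x, hx⟩)) :=
    ConcreteCategory.congr_hom (ShortComplex.cyclesMap_i φ) _
  have h3 := ConcreteCategory.congr_hom S.moduleCatCyclesIso_inv_iCycles ⟨x, hx⟩
  have h4 := ConcreteCategory.congr_hom T.moduleCatCyclesIso_inv_iCycles
    ⟨φ.τ₂ x, comm₂₃_eq_zero φ hx⟩
  exact (h2.trans (congrArg φ.τ₂ h3)).trans h4.symm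

theorem epi_homologyMap (φ : S ⟶ T)
    (h : ∀ y, T.g y = 0 → ∃ x, S.g x = 0 ∧ ∃ z, T.f z = φ.τ₂ x - y) :
    Epi (ShortComplex.homologyMap φ) := by
  rw [ModuleCat.epi_iff_surjective]
  intro c
  obtain ⟨y, hy, rfl⟩ := exists_homologyClass_eq c
  obtain ⟨x, hx, hz⟩ := h y hy
  exact ⟨homologyClass S x hx, by
    rw [homologyMap_homologyClass, homologyClass_eq_iff]; exact hz⟩

theorem mono_homologyMap (φ : S ⟶ T)
    (h : ∀ x, S.g x = 0 → (∃ z, T.f z = φ.τ₂ x) → ∃ w, S.f w = x) :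
    Mono (ShortComplex.homologyMap φ) := by
  rw [ModuleCat.mono_iff_injective, injective_iff_map_eq_zero]
  intro c hc
  obtain ⟨x, hx, rfl⟩ := exists_homologyClass_eq c
  rw [homologyMap_homologyClass, homologyClass_eq_zero_iff] at hc
  exact homologyClass_eq_zero_iff.2 (h x hx hc)

/-- Exactness of `H(S) → H(T) → H(U)` in the middle, in terms of cycles. -/
theorem exists_homologyMap_eq (φ : S ⟶ T) (ψ : T ⟶ U)
    (h : ∀ y, T.g y = 0 → (∃ z, U.f z = ψ.τ₂ y) → ∃ x, S.g x = 0 ∧ ∃ w, T.f w = φ.τ₂ x - y)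
    (c : T.homology) (hc : ShortComplex.homologyMap ψ c = 0) :
    ∃ b, ShortComplex.homologyMap φ b = c := by
  obtain ⟨y, hy, rfl⟩ := exists_homologyClass_eq c
  rw [homologyMap_homologyClass, homologyClass_eq_zero_iff] at hc
  obtain ⟨x, hx, hw⟩ := h y hy hc
  exact ⟨homologyClass S x hx, by
    rw [homologyMap_homologyClass, homologyClass_eq_iff]; exact hw⟩

end Homology

/-! ### Products in the symmetric square -/

section SymmetricSquare

variable {R : Type} [CommRing R] {M N : Type u} [AddCommGroup M] [Module R M]
  [AddCommGroup N] [Module R N]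

variable (R M) in
/-- The product `M × M → SP²(M)`, `(x, y) ↦ x y`, as a bilinear map. -/
def symMul : M →ₗ[R] M →ₗ[R] SymmetricPower R (Fin 2) M :=
  LinearMap.mk₂ R (fun x y => SymmetricPower.tprod R ![x, y])
    (fun x x' y => by
      simpa only [update_zero_fin_two] using
        (SymmetricPower.tprod R (ι := Fin 2) (M := M)).map_update_add ![0, y] 0 x x')
    (fun c x y => by
      simpa only [update_zero_fin_two] using
        (SymmetricPower.tprod R (ι := Fin 2) (M := M)).map_update_smul ![0, y] 0 c x)
    (fun x y y' => by
      simpa only [update_one_fin_two] using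
        (SymmetricPower.tprod R (ι := Fin 2) (M := M)).map_update_add ![x, 0] 1 y y')
    (fun c x y => by
      simpa only [update_one_fin_two] using
        (SymmetricPower.tprod R (ι := Fin 2) (M := M)).map_update_smul ![x, 0] 1 c y)

theorem symMul_comm (x y : M) : symMul R M x y = symMul R M y x := by
  change SymmetricPower.tprod R ![x, y] = SymmetricPower.tprod R ![y, x]
  rw [← SymmetricPower.tprod_equiv (R := R) (Equiv.swap (0 : Fin 2) 1)]
  congr 1
  funext i
  fin_cases i <;> simp

theorem symPowerMap_symMul (f : M →ₗ[R] N) (x y : M) :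
    symPowerMap 2 f (symMul R M x y) = symMul R N (f x) (f y) := by
  change symPowerMap 2 f (SymmetricPower.tprod R ![x, y]) = SymmetricPower.tprod R ![f x, f y]
  rw [symPowerMap_tprod]
  congr 1
  funext i
  fin_cases i <;> rfl

theorem mem_of_symMul_mem (p : Submodule R (SymmetricPower R (Fin 2) M))
    (h : ∀ x y, symMul R M x y ∈ p) (z : SymmetricPower R (Fin 2) M) : z ∈ p := by
  have : (⊤ : Submodule R (SymmetricPower R (Fin 2) M)) ≤ p := by
    rw [← SymmetricPower.span_tprod_eq_top, Submodule.span_le]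
    rintro _ ⟨v, rfl⟩
    have hv : v = ![v 0, v 1] := by
      funext i
      fin_cases i <;> rfl
    rw [hv]
    exact h _ _
  exact this trivial

theorem symSquare_hom_ext {P : Type*} [AddCommGroup P] [Module R P]
    {f g : SymmetricPower R (Fin 2) M →ₗ[R] P}
    (h : ∀ x y, f (symMul R M x y) = g (symMul R M x y)) (z : SymmetricPower R (Fin 2) M) :
    f z = g z :=
  mem_of_symMul_mem (LinearMap.eqLocus f g) h z

theorem symPowerMap_injective_of_bijective {f : M →ₗ[R] N} (hf : Function.Bijective f) :
    Function.Injective (symPowerMap 2 f) := by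
  let e := LinearEquiv.ofBijective f hf
  refine Function.LeftInverse.injective (g := symPowerMap 2 e.symm.toLinearMap) ?_
  refine symSquare_hom_ext (f := symPowerMap 2 e.symm.toLinearMap ∘ₗ symPowerMap 2 f)
    (g := LinearMap.id) fun x y => ?_
  rw [LinearMap.comp_apply, symPowerMap_symMul, symPowerMap_symMul]
  exact congrArg₂ (fun a b => symMul R M a b) (e.symm_apply_apply x) (e.symm_apply_apply y)

/-- The linear map `SP²(M) → P`, `x y ↦ f x y`, for a symmetric bilinear map `f`. -/
def symSquareLift {P : Type*} [AddCommGroup P] [Module R P] (f : M →ₗ[R] M →ₗ[R] P)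
    (hf : ∀ x y, f x y = f y x) : SymmetricPower R (Fin 2) M →ₗ[R] P :=
  let g : (⨂[R] _ : Fin 2, M) →ₗ[R] P := PiTensorProduct.lift
    { toFun := fun v => f (v 0) (v 1)
      map_update_add' := fun v i x y => by
        fin_cases i <;> simp [Function.update]
      map_update_smul' := fun v i c x => by
        fin_cases i <;> simp [Function.update] }
  { toFun := AddCon.lift (addConGen (SymmetricPower.Rel R (Fin 2) M)) g.toAddMonoidHom (by
      refine AddCon.addConGen_le.2 ?_
      intro x y h
      cases h with
      | perm e v =>
        have he : ∀ e : Equiv.Perm (Fin 2), e = 1 ∨ e = Equiv.swap 0 1 := by decide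
        rw [AddCon.ker_rel]
        rcases he e with rfl | rfl
        · rfl
        · simp only [LinearMap.toAddMonoidHom_coe, g, PiTensorProduct.lift.tprod]
          exact hf _ _)
    map_add' := map_add _
    map_smul' := fun r x => AddCon.induction_on x fun y => g.map_smul r y }

theorem symSquareLift_symMul {P : Type*} [AddCommGroup P] [Module R P] (f : M →ₗ[R] M →ₗ[R] P)
    (hf : ∀ x y, f x y = f y x) (x y : M) : symSquareLift f hf (symMul R M x y) = f x y := by
  change PiTensorProduct.lift _ (PiTensorProduct.tprod R ![x, y]) = _
  rw [PiTensorProduct.lift.tprod]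
  rfl

end SymmetricSquare

/-! ### The symmetric square of a simplicial module -/

section Simplicial

open Simplicial

variable {R : Type} [CommRing R]

/-- The part in degrees `2`, `1`, `0` of the alternating face map complex of `SP²(X)`. -/
def symSquareComplex (X : SimplicialObject (ModuleCat.{u} R)) : ShortComplex (ModuleCat.{u} R) :=
  ((AlgebraicTopology.alternatingFaceMapComplex (ModuleCat.{u} R)).obj
    (((SimplicialObject.whiskering _ _).obj (SP2 R)).obj X)).sc' 2 1 0

/-- The map induced by a simplicial map `X → Y`. -/
def symSquareComplexMap {X Y : SimplicialObject (ModuleCat.{u} R)} (f : X ⟶ Y) :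
    symSquareComplex X ⟶ symSquareComplex Y :=
  (HomologicalComplex.shortComplexFunctor' _ _ 2 1 0).map
    ((AlgebraicTopology.alternatingFaceMapComplex (ModuleCat.{u} R)).map
      (((SimplicialObject.whiskering _ _).obj (SP2 R)).map f))

variable (X : SimplicialObject (ModuleCat.{u} R))

/-- The face maps, as linear maps. -/
def face {n : ℕ} (k : Fin (n + 2)) : X _⦋n + 1⦌ →ₗ[R] X _⦋n⦌ := (X.δ k).hom

/-- The degeneracy maps, as linear maps. -/
def degen {n : ℕ} (k : Fin (n + 1)) : X _⦋n⦌ →ₗ[R] X _⦋n + 1⦌ := (X.σ k).hom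

section Identities

theorem face_zero_face_one (x : X _⦋2⦌) :
    face X (n := 0) 0 (face X (n := 1) 1 x) = face X (n := 0) 0 (face X (n := 1) 0 x) :=
  ConcreteCategory.congr_hom (X.δ_comp_δ (n := 0) (i := 0) (j := 0) le_rfl) x

theorem face_zero_face_two (x : X _⦋2⦌) :
    face X (n := 0) 0 (face X (n := 1) 2 x) = face X (n := 0) 1 (face X (n := 1) 0 x) :=
  ConcreteCategory.congr_hom (X.δ_comp_δ (n := 0) (i := 0) (j := 1) (Fin.zero_le _)) x

theorem face_one_face_two (x : X _⦋2⦌) :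
    face X (n := 0) 1 (face X (n := 1) 2 x) = face X (n := 0) 1 (face X (n := 1) 1 x) :=
  ConcreteCategory.congr_hom (X.δ_comp_δ (n := 0) (i := 1) (j := 1) le_rfl) x

theorem face_zero_degen (x : X _⦋0⦌) : face X (n := 0) 0 (degen X (n := 0) 0 x) = x :=
  ConcreteCategory.congr_hom (X.δ_comp_σ_self (n := 0) (i := 0)) x

theorem face_one_degen (x : X _⦋0⦌) : face X (n := 0) 1 (degen X (n := 0) 0 x) = x :=
  ConcreteCategory.congr_hom (X.δ_comp_σ_succ (n := 0) (i := 0)) x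

theorem face_zero_degen_zero (x : X _⦋1⦌) : face X (n := 1) 0 (degen X (n := 1) 0 x) = x :=
  ConcreteCategory.congr_hom (X.δ_comp_σ_self (n := 1) (i := 0)) x

theorem face_one_degen_zero (x : X _⦋1⦌) : face X (n := 1) 1 (degen X (n := 1) 0 x) = x :=
  ConcreteCategory.congr_hom (X.δ_comp_σ_succ (n := 1) (i := 0)) x

theorem face_two_degen_zero (x : X _⦋1⦌) :
    face X (n := 1) 2 (degen X (n := 1) 0 x) = degen X (n := 0) 0 (face X (n := 0) 1 x) :=
  ConcreteCategory.congr_hom (X.δ_comp_σ_of_gt (n := 0) (i := 1) (j := 0) (by decide)) x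

theorem face_zero_degen_one (x : X _⦋1⦌) :
    face X (n := 1) 0 (degen X (n := 1) 1 x) = degen X (n := 0) 0 (face X (n := 0) 0 x) :=
  ConcreteCategory.congr_hom (X.δ_comp_σ_of_le (n := 0) (i := 0) (j := 0) (by decide)) x

theorem face_one_degen_one (x : X _⦋1⦌) : face X (n := 1) 1 (degen X (n := 1) 1 x) = x :=
  ConcreteCategory.congr_hom (X.δ_comp_σ_self (n := 1) (i := 1)) x

theorem face_two_degen_one (x : X _⦋1⦌) : face X (n := 1) 2 (degen X (n := 1) 1 x) = x :=
  ConcreteCategory.congr_hom (X.δ_comp_σ_succ (n := 1) (i := 1)) x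

end Identities

theorem symSquareComplex_f_symMul (x y : X _⦋2⦌) :
    (symSquareComplex X).f (symMul R (X _⦋2⦌) x y) =
      symMul R (X _⦋1⦌) (face X (n := 1) 0 x) (face X (n := 1) 0 y) -
      symMul R (X _⦋1⦌) (face X (n := 1) 1 x) (face X (n := 1) 1 y) +
      symMul R (X _⦋1⦌) (face X (n := 1) 2 x) (face X (n := 1) 2 y) := by
  have h : (symSquareComplex X).f =
      ModuleCat.ofHom (symPowerMap 2 (face X (n := 1) 0) - symPowerMap 2 (face X (n := 1) 1) +
        symPowerMap 2 (face X (n := 1) 2)) := by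
    refine (AlgebraicTopology.AlternatingFaceMapComplex.obj_d_eq _ 1).trans ?_
    rw [Fin.sum_univ_three]
    have h' : ∀ {M N : ModuleCat.{u} R} (a b c : M ⟶ N),
        (-1 : ℤ) ^ 0 • a + (-1 : ℤ) ^ 1 • b + (-1 : ℤ) ^ 2 • c = a - b + c := by
      intro M N a b c
      simp [sub_eq_add_neg]
    exact h' _ _ _
  rw [h]
  change symPowerMap 2 _ _ - symPowerMap 2 _ _ + symPowerMap 2 _ _ = _
  simp only [symPowerMap_symMul]

theorem symSquareComplex_g_symMul (x y : X _⦋1⦌) :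
    (symSquareComplex X).g (symMul R (X _⦋1⦌) x y) =
      symMul R (X _⦋0⦌) (face X (n := 0) 0 x) (face X (n := 0) 0 y) -
      symMul R (X _⦋0⦌) (face X (n := 0) 1 x) (face X (n := 0) 1 y) := by
  have h : (symSquareComplex X).g =
      ModuleCat.ofHom (symPowerMap 2 (face X (n := 0) 0) - symPowerMap 2 (face X (n := 0) 1)) := by
    refine (AlgebraicTopology.AlternatingFaceMapComplex.obj_d_eq _ 0).trans ?_
    rw [Fin.sum_univ_two]
    have h' : ∀ {M N : ModuleCat.{u} R} (a b : M ⟶ N),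
        (-1 : ℤ) ^ 0 • a + (-1 : ℤ) ^ 1 • b = a - b := by
      intro M N a b
      simp [sub_eq_add_neg]
    exact h' _ _
  rw [h]
  change symPowerMap 2 _ _ - symPowerMap 2 _ _ = _
  simp only [symPowerMap_symMul]

theorem degen_naturality {X Y : SimplicialObject (ModuleCat.{u} R)} (f : X ⟶ Y) {n : ℕ}
    (k : Fin (n + 1)) (x : X _⦋n⦌) :
    degen Y k (f.app (.op ⦋n⦌) x) = f.app (.op ⦋n + 1⦌) (degen X k x) :=
  (ConcreteCategory.congr_hom (SimplicialObject.σ_naturality f k) x).symm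

variable {E : Type u} [AddCommGroup E] [Module R E] {I : Submodule R E}
  (j : E →ₗ[R] X _⦋0⦌) (i : I →ₗ[R] X _⦋1⦌)

/-- The bilinear map `(a, e) ↦ i(a) s₀ j(e)` as a map `I ⊗ E → SP²(X₁)`. -/
def koszulToSymSquareOne : I ⊗[R] E →ₗ[R] SymmetricPower R (Fin 2) (X _⦋1⦌) :=
  TensorProduct.lift ((symMul R (X _⦋1⦌)).compl₁₂ i (degen X (n := 0) 0 ∘ₗ j))

theorem koszulToSymSquareOne_tmul (a : I) (e : E) :
    koszulToSymSquareOne X j i (a ⊗ₜ e) =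
      symMul R (X _⦋1⦌) (i a) (degen X (n := 0) 0 (j e)) := rfl

/-- The map `Λ²(I) → SP²(X₂)`, `a ∧ b ↦ s₁i(b) s₀i(a) - s₁i(a) s₀i(b)`, the
shuffle product of `i(a)` and `i(b)` up to sign. -/
def koszulToSymSquareTwo : ⋀[R]^2 I →ₗ[R] SymmetricPower R (Fin 2) (X _⦋2⦌) :=
  exteriorPower.alternatingMapLinearEquiv
    { toFun := fun v =>
        symMul R (X _⦋2⦌) (degen X (n := 1) 1 (i (v 1))) (degen X (n := 1) 0 (i (v 0))) -
        symMul R (X _⦋2⦌) (degen X (n := 1) 1 (i (v 0))) (degen X (n := 1) 0 (i (v 1)))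
      map_update_add' := fun v k x y => by
        fin_cases k <;> simp [Function.update] <;> abel
      map_update_smul' := fun v k c x => by
        fin_cases k <;> simp [Function.update, smul_sub]
      map_eq_zero_of_eq' := fun v k l h hkl => by
        have h01 : v 0 = v 1 := by
          fin_cases k <;> fin_cases l <;> simp_all
        simp [h01] }

theorem koszulToSymSquareTwo_ιMulti (v : Fin 2 → I) :
    koszulToSymSquareTwo X i (exteriorPower.ιMulti R 2 v) =
      symMul R (X _⦋2⦌) (degen X (n := 1) 1 (i (v 1))) (degen X (n := 1) 0 (i (v 0))) -
      symMul R (X _⦋2⦌) (degen X (n := 1) 1 (i (v 0))) (degen X (n := 1) 0 (i (v 1))) := by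
  rw [koszulToSymSquareTwo, exteriorPower.alternatingMapLinearEquiv_apply_ιMulti]
  rfl

variable (h0 : ∀ a, face X (n := 0) 0 (i a) = j a) (h1 : ∀ a, face X (n := 0) 1 (i a) = 0)

include h0 h1 in
theorem symSquareComplex_g_koszulToSymSquareOne (t : I ⊗[R] E) :
    (symSquareComplex X).g (koszulToSymSquareOne X j i t) = symPowerMap 2 j (koszulOne E I t) := by
  refine LinearMap.congr_fun (f := (symSquareComplex X).g.hom ∘ₗ koszulToSymSquareOne X j i)
    (g := symPowerMap 2 j ∘ₗ koszulOne E I) (TensorProduct.ext' fun x y => ?_) t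
  change (symSquareComplex X).g (koszulToSymSquareOne X j i (x ⊗ₜ y)) =
    symPowerMap 2 j (koszulOne E I (x ⊗ₜ y))
  rw [koszulToSymSquareOne_tmul]
  refine (symSquareComplex_g_symMul X _ _).trans ?_
  rw [h0, h1, face_zero_degen, map_zero, LinearMap.zero_apply, sub_zero]
  exact (symPowerMap_symMul j (x : E) y).symm

/-- The comparison map from the Koszul-type complex of `I ⊆ E` to the complex of `SP²(X)`, for
maps `j : E → X₀` and `i : I → ker (d₁ : X₁ → X₀)` with `d₀ i = j`. -/
def koszulToSymSquare : koszul E I ⟶ symSquareComplex X where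
  τ₁ := ModuleCat.ofHom (koszulToSymSquareTwo X i)
  τ₂ := ModuleCat.ofHom (koszulToSymSquareOne X j i)
  τ₃ := ModuleCat.ofHom (symPowerMap 2 j)
  comm₁₂ := by
    ext1
    refine exteriorPower.linearMap_ext ?_
    ext v
    change (symSquareComplex X).f (koszulToSymSquareTwo X i (exteriorPower.ιMulti R 2 v)) =
      koszulToSymSquareOne X j i (koszulTwo E I (exteriorPower.ιMulti R 2 v))
    rw [koszulToSymSquareTwo_ιMulti, koszulTwo_ιMulti]
    refine (map_sub (symSquareComplex X).f.hom _ _).trans ?_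
    refine (congrArg₂ _ (symSquareComplex_f_symMul X _ _)
      (symSquareComplex_f_symMul X _ _)).trans ?_
    rw [map_sub, koszulToSymSquareOne_tmul, koszulToSymSquareOne_tmul]
    simp only [face_zero_degen_one, face_zero_degen_zero, face_one_degen_one,
      face_one_degen_zero, face_two_degen_one, face_two_degen_zero, h0, h1, map_zero,
      symMul_comm (degen X (n := 0) 0 _), symMul_comm (i (v 1)) (i (v 0))]
    abel
  comm₂₃ := by
    ext1
    exact LinearMap.ext (symSquareComplex_g_koszulToSymSquareOne X j i h0 h1)

theorem koszulToSymSquare_naturality {Y : SimplicialObject (ModuleCat.{u} R)} {E' : Type u}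
    [AddCommGroup E'] [Module R E'] {I' : Submodule R E'}
    (j' : E' →ₗ[R] Y _⦋0⦌) (i' : I' →ₗ[R] Y _⦋1⦌)
    (h0' : ∀ a, face Y (n := 0) 0 (i' a) = j' a) (h1' : ∀ a, face Y (n := 0) 1 (i' a) = 0)
    (f : E →ₗ[R] E') (hf : I ≤ I'.comap f) (φ : X ⟶ Y)
    (hj : ∀ e, j' (f e) = φ.app (.op ⦋0⦌) (j e))
    (hi : ∀ a, i' (f.restrict hf a) = φ.app (.op ⦋1⦌) (i a)) :
    koszulToSymSquare X j i h0 h1 ≫ symSquareComplexMap φ =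
      koszulMap f hf ≫ koszulToSymSquare Y j' i' h0' h1' := by
  apply ShortComplex.hom_ext
  · ext1
    refine exteriorPower.linearMap_ext ?_
    ext v
    change symPowerMap 2 (φ.app (.op ⦋2⦌)).hom
        (koszulToSymSquareTwo X i (exteriorPower.ιMulti R 2 v)) =
      koszulToSymSquareTwo Y i' (exteriorPower.map 2 _ (exteriorPower.ιMulti R 2 v))
    rw [exteriorPower.map_apply_ιMulti, koszulToSymSquareTwo_ιMulti, koszulToSymSquareTwo_ιMulti,
      map_sub, symPowerMap_symMul, symPowerMap_symMul]
    simp only [Function.comp_apply, hi, degen_naturality]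
  · ext1
    refine TensorProduct.ext' fun x y => ?_
    change symPowerMap 2 (φ.app (.op ⦋1⦌)).hom (koszulToSymSquareOne X j i (x ⊗ₜ y)) =
      koszulToSymSquareOne Y j' i' (f.restrict hf x ⊗ₜ f y)
    rw [koszulToSymSquareOne_tmul, koszulToSymSquareOne_tmul, symPowerMap_symMul, hi, hj,
      degen_naturality]
  · ext1
    refine LinearMap.ext (symSquare_hom_ext fun x y => ?_)
    change symPowerMap 2 (φ.app (.op ⦋0⦌)).hom (symPowerMap 2 j (symMul R E x y)) =
      symPowerMap 2 j' (symPowerMap 2 f (symMul R E x y))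
    simp only [symPowerMap_symMul, hj]

section Isomorphism

variable (hN : ∀ x : X _⦋2⦌, face X (n := 1) 1 x = 0 → face X (n := 1) 2 x = 0 → x = 0)

/-- The projection of `X₁ = s₀(X₀) ⊕ ker d₁` onto `ker d₁`. -/
def normalPart : X _⦋1⦌ →ₗ[R] X _⦋1⦌ :=
  LinearMap.id - degen X (n := 0) 0 ∘ₗ face X (n := 0) 1

theorem normalPart_apply (x : X _⦋1⦌) :
    normalPart X x = x - degen X (n := 0) 0 (face X (n := 0) 1 x) := rfl

theorem face_one_normalPart (x : X _⦋1⦌) : face X (n := 0) 1 (normalPart X x) = 0 := by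
  rw [normalPart_apply, map_sub, face_one_degen, sub_self]

theorem normalPart_degen (x : X _⦋0⦌) : normalPart X (degen X (n := 0) 0 x) = 0 := by
  rw [normalPart_apply, face_one_degen, sub_self]

theorem normalPart_of_face_one {x : X _⦋1⦌} (hx : face X (n := 0) 1 x = 0) :
    normalPart X x = x := by
  rw [normalPart_apply, hx, map_zero, sub_zero]

include hN in
/-- Since `N₂(X) = 0`, every `x` in `X₂` is the sum of degenerate elements determined by `d₁ x` and
`d₂ x`; the formula for the normal part of `d₀ x` follows. -/
theorem normalPart_face_zero (x : X _⦋2⦌) :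
    normalPart X (face X (n := 1) 0 x) =
      normalPart X (face X (n := 1) 1 x) - normalPart X (face X (n := 1) 2 x) := by
  set p := face X (n := 0) 1 (face X (n := 1) 2 x) with hp
  set b := normalPart X (face X (n := 1) 2 x) with hb
  set a := normalPart X (face X (n := 1) 1 x) - b with ha
  have hp' : face X (n := 0) 1 (face X (n := 1) 1 x) = p := (face_one_face_two X x).symm
  have hb1 : face X (n := 0) 1 b = 0 := face_one_normalPart X _
  have ha1 : face X (n := 0) 1 a = 0 := by
    rw [ha, map_sub, hb1, face_one_normalPart, sub_zero]
  have hx : x - degen X (n := 1) 0 (degen X (n := 0) 0 p) - degen X (n := 1) 0 a -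
      degen X (n := 1) 1 b = 0 := by
    apply hN
    · simp only [map_sub, face_one_degen_zero, face_one_degen_one]
      rw [ha, normalPart_apply, hp']
      abel
    · simp only [map_sub, face_two_degen_zero, face_two_degen_one, ha1, face_one_degen]
      rw [hb, normalPart_apply, ← hp, map_zero]
      abel
  have hx0 := congrArg (fun y => normalPart X (face X (n := 1) 0 y)) hx
  simp only [map_sub, face_zero_degen_zero, face_zero_degen_one, normalPart_degen,
    normalPart_of_face_one X ha1, map_zero, sub_zero] at hx0
  exact sub_eq_zero.1 hx0

variable (hj : Function.Bijective j) (hi : Function.Injective i)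
  (hir : ∀ x, face X (n := 0) 1 x = 0 → ∃ a, i a = x)

include hj hi hir hN h0 h1 in
/-- A retraction modulo the image of `Λ²(I)`, which vanishes on boundaries. -/
theorem exists_koszul_retraction :
    ∃ ρ : SymmetricPower R (Fin 2) (X _⦋1⦌) →ₗ[R]
        (I ⊗[R] E ⧸ LinearMap.range (koszulTwo E I)),
      (∀ t, ρ (koszulToSymSquareOne X j i t) = Submodule.Quotient.mk t) ∧
      ∀ z, ρ ((symSquareComplex X).f z) = 0 := by
  obtain ⟨m, hm⟩ : ∃ m : X _⦋1⦌ →ₗ[R] I, ∀ x, i (m x) = normalPart X x := by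
    let e := LinearEquiv.ofInjective i hi
    refine ⟨e.symm.toLinearMap ∘ₗ (normalPart X).codRestrict _ fun x => by
      simpa using hir _ (face_one_normalPart X x), fun x => ?_⟩
    exact congrArg Subtype.val (e.apply_symm_apply
      ⟨normalPart X x, by simpa using hir _ (face_one_normalPart X x)⟩)
  let J := LinearEquiv.ofBijective j hj
  have hJ : ∀ a : I, (a : E) = J.symm (face X (n := 0) 0 (i a)) := fun a => by
    rw [h0]
    exact (J.symm_apply_apply _).symm
  let d0 : X _⦋1⦌ →ₗ[R] E := J.symm.toLinearMap ∘ₗ face X (n := 0) 0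
  let d1 : X _⦋1⦌ →ₗ[R] E := J.symm.toLinearMap ∘ₗ face X (n := 0) 1
  have hd : ∀ x, d0 x - d1 x = m x := fun x => by
    rw [hJ, hm, normalPart_apply, map_sub, face_zero_degen, map_sub]
    rfl
  have hswap : ∀ a b : I, (Submodule.Quotient.mk (a ⊗ₜ[R] (b : E)) :
      I ⊗[R] E ⧸ LinearMap.range (koszulTwo E I)) = Submodule.Quotient.mk (b ⊗ₜ[R] (a : E)) := by
    intro a b
    rw [Submodule.Quotient.eq]
    exact ⟨exteriorPower.ιMulti R 2 ![a, b], koszulTwo_ιMulti E I _⟩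
  let β : X _⦋1⦌ →ₗ[R] X _⦋1⦌ →ₗ[R] (I ⊗[R] E ⧸ LinearMap.range (koszulTwo E I)) :=
    ((TensorProduct.mk R I E).compl₁₂ m d0 +
      ((TensorProduct.mk R I E).compl₁₂ m d1).flip).compr₂ (Submodule.mkQ _)
  have hβ : ∀ x y, β x y = Submodule.Quotient.mk (m x ⊗ₜ d0 y + m y ⊗ₜ d1 x) := fun _ _ => rfl
  have hsymm : ∀ x y, β x y = β y x := by
    intro x y
    have h := hswap (m x) (m y)
    rw [← hd x, ← hd y] at h
    simp only [hβ, TensorProduct.tmul_sub, Submodule.Quotient.mk_sub,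
      Submodule.Quotient.mk_add] at h ⊢
    rw [sub_eq_sub_iff_add_eq_add] at h
    rw [h]
  refine ⟨symSquareLift β hsymm, fun t => ?_, fun z => ?_⟩
  · refine LinearMap.congr_fun (f := symSquareLift β hsymm ∘ₗ koszulToSymSquareOne X j i)
      (g := Submodule.mkQ _) (TensorProduct.ext' fun a e => ?_) t
    rw [LinearMap.comp_apply, koszulToSymSquareOne_tmul, symSquareLift_symMul, hβ]
    have e1 : m (i a) = a := hi (by rw [hm, normalPart_of_face_one X (h1 a)])
    have e2 : d0 (degen X (n := 0) 0 (j e)) = e := by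
      change J.symm (face X (n := 0) 0 _) = e
      rw [face_zero_degen]
      exact J.symm_apply_apply e
    have e3 : m (degen X (n := 0) 0 (j e)) = 0 := hi (by rw [hm, normalPart_degen, map_zero])
    rw [e1, e2, e3, TensorProduct.zero_tmul, add_zero]
    rfl
  · refine symSquare_hom_ext (M := X _⦋2⦌) (g := 0)
      (f := symSquareLift β hsymm ∘ₗ (symSquareComplex X).f.hom) (fun x y => ?_) z
    have hmx : ∀ x, m (face X (n := 1) 0 x) =
        m (face X (n := 1) 1 x) - m (face X (n := 1) 2 x) := fun x => hi (by
      rw [map_sub, hm, hm, hm, normalPart_face_zero X hN])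
    have hu : ∀ y, d0 (face X (n := 1) 1 y) = d0 (face X (n := 1) 0 y) := fun y =>
      congrArg J.symm (face_zero_face_one X y)
    have hv : ∀ y, d0 (face X (n := 1) 2 y) = d1 (face X (n := 1) 0 y) := fun y =>
      congrArg J.symm (face_zero_face_two X y)
    have hw : ∀ y, d1 (face X (n := 1) 2 y) = d1 (face X (n := 1) 1 y) := fun y =>
      congrArg J.symm (face_one_face_two X y)
    refine (congrArg (symSquareLift β hsymm) (symSquareComplex_f_symMul X x y)).trans ?_
    rw [map_add, map_sub, symSquareLift_symMul, symSquareLift_symMul, symSquareLift_symMul,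
      LinearMap.zero_apply]
    have h := hswap (m (face X (n := 1) 0 y)) (m (face X (n := 1) 2 x))
    rw [← hd, ← hd, hv, hw] at h
    have hy2 : m (face X (n := 1) 2 y) =
        m (face X (n := 1) 1 y) - m (face X (n := 1) 0 y) := by rw [hmx y]; abel
    simp only [hβ, hu, hv, hw, hmx x, hy2]
    simp only [TensorProduct.tmul_sub, TensorProduct.sub_tmul, Submodule.Quotient.mk_sub,
      Submodule.Quotient.mk_add] at h ⊢
    rw [sub_eq_sub_iff_add_eq_add] at h
    rw [← sub_eq_zero] at h
    refine Eq.trans ?_ h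
    abel

/-- Modulo boundaries, every element of `SP²(X₁)` comes from `I ⊗ E`. -/
theorem exists_boundary_eq_koszulToSymSquareOne_sub (hj : Function.Surjective j)
    (hir : ∀ x, face X (n := 0) 1 x = 0 → ∃ a, i a = x)
    (c : SymmetricPower R (Fin 2) (X _⦋1⦌)) :
    ∃ t z, (symSquareComplex X).f z = koszulToSymSquareOne X j i t - c := by
  let p : Submodule R (SymmetricPower R (Fin 2) (X _⦋1⦌)) :=
    LinearMap.range (koszulToSymSquareOne X j i) ⊔ LinearMap.range (symSquareComplex X).f.hom
  suffices hc : c ∈ p by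
    obtain ⟨_, ⟨t, rfl⟩, _, ⟨z, rfl⟩, h⟩ := Submodule.mem_sup.1 hc
    refine ⟨t, -z, ?_⟩
    rw [← h]
    refine (map_neg (symSquareComplex X).f.hom z).trans ?_
    abel
  refine mem_of_symMul_mem p (fun x y => ?_) c
  have hbd : ∀ z w : X _⦋2⦌, symMul R (X _⦋1⦌) (face X (n := 1) 0 z) (face X (n := 1) 0 w) -
      symMul R (X _⦋1⦌) (face X (n := 1) 1 z) (face X (n := 1) 1 w) +
      symMul R (X _⦋1⦌) (face X (n := 1) 2 z) (face X (n := 1) 2 w) ∈ p := fun z w =>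
    Submodule.mem_sup_right ⟨_, symSquareComplex_f_symMul X z w⟩
  -- Products of an element of `ker d₁` and a degenerate element are in the image of `I ⊗ E`.
  have hθ : ∀ (a : X _⦋1⦌) (e : X _⦋0⦌), face X (n := 0) 1 a = 0 →
      symMul R (X _⦋1⦌) a (degen X (n := 0) 0 e) ∈ p := by
    intro a e ha
    obtain ⟨a, rfl⟩ := hir a ha
    obtain ⟨e, rfl⟩ := hj e
    exact Submodule.mem_sup_left ⟨a ⊗ₜ e, koszulToSymSquareOne_tmul X j i a e⟩
  obtain ⟨a, ha, hx⟩ : ∃ a, face X (n := 0) 1 a = 0 ∧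
      x = a + degen X (n := 0) 0 (face X (n := 0) 1 x) :=
    ⟨normalPart X x, face_one_normalPart X x, by rw [normalPart_apply, sub_add_cancel]⟩
  obtain ⟨b, hb, hy⟩ : ∃ b, face X (n := 0) 1 b = 0 ∧
      y = b + degen X (n := 0) 0 (face X (n := 0) 1 y) :=
    ⟨normalPart X y, face_one_normalPart X y, by rw [normalPart_apply, sub_add_cancel]⟩
  rw [hx, hy, map_add, map_add, LinearMap.add_apply, LinearMap.add_apply]
  refine add_mem (add_mem ?_ ?_) (add_mem ?_ ?_)
  · -- The boundary of `s₁(a) s₀(b)` is `s₀d₀(a) b - a b`.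
    have h := hbd (degen X (n := 1) 1 a) (degen X (n := 1) 0 b)
    simp only [face_zero_degen_one, face_zero_degen_zero, face_one_degen_one,
      face_one_degen_zero, face_two_degen_zero, hb, map_zero, add_zero] at h
    have h' := sub_mem (hθ b (face X (n := 0) 0 a) hb) h
    rwa [symMul_comm b, sub_sub_cancel] at h'
  · rw [symMul_comm]
    exact hθ _ _ hb
  · exact hθ _ _ ha
  · -- A product of degenerate elements is the boundary of a product of degenerate elements.
    have h := hbd (degen X (n := 1) 0 (degen X (n := 0) 0 (face X (n := 0) 1 x)))
      (degen X (n := 1) 0 (degen X (n := 0) 0 (face X (n := 0) 1 y)))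
    simpa only [face_zero_degen_zero, face_one_degen_zero, face_two_degen_zero, face_one_degen,
      sub_self, zero_add] using h

include hj hi hir hN in
theorem isIso_homologyMap_koszulToSymSquare :
    IsIso (ShortComplex.homologyMap (koszulToSymSquare X j i h0 h1)) := by
  have : Mono (ShortComplex.homologyMap (koszulToSymSquare X j i h0 h1)) := by
    refine mono_homologyMap _ fun t _ ⟨z, hz⟩ => ?_
    obtain ⟨ρ, hρ, hρ'⟩ := exists_koszul_retraction X j i h0 h1 hN hj hi hir
    have h := (hρ t).symm.trans ((congrArg ρ hz).symm.trans (hρ' z))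
    exact (Submodule.Quotient.mk_eq_zero _).1 h
  have : Epi (ShortComplex.homologyMap (koszulToSymSquare X j i h0 h1)) := by
    refine epi_homologyMap _ fun c hc => ?_
    obtain ⟨t, z, hz⟩ := exists_boundary_eq_koszulToSymSquareOne_sub X j i hj.surjective hir c
    refine ⟨t, ?_, z, hz⟩
    -- `SP²(j)` is injective, so that `t` is a cycle because its image is.
    apply symPowerMap_injective_of_bijective hj
    have h3 : (symSquareComplex X).g (koszulToSymSquareOne X j i t) = 0 :=
      g_eq_zero_of_f_eq_sub hz hc
    exact ((symSquareComplex_g_koszulToSymSquareOne X j i h0 h1 t).symm.trans h3).trans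
      (map_zero _).symm
  exact isIso_of_mono_of_epi _

end Isomorphism

end Simplicial

/-! ### Comparison of `L₁SP²` with the Koszul-type complex of the free resolution -/

section MooreComplex

open Simplicial AlgebraicTopology

variable {R : Type} [CommRing R] (X : SimplicialObject (ModuleCat.{u} R))

/-- The inclusion `Nₙ(X) → Xₙ` of the normalized Moore complex, as a linear map. -/
def mooreInclusion (n : ℕ) : ((normalizedMooreComplex (ModuleCat.{u} R)).obj X).X n →ₗ[R] X _⦋n⦌ :=
  ((NormalizedMooreComplex.objX X n).arrow).hom

theorem mooreInclusion_injective (n : ℕ) : Function.Injective (mooreInclusion X n) :=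
  (ModuleCat.mono_iff_injective (NormalizedMooreComplex.objX X n).arrow).1 inferInstance

theorem mooreInclusion_zero_bijective : Function.Bijective (mooreInclusion X 0) := by
  have : IsIso (NormalizedMooreComplex.objX X 0).arrow := by
    rw [NormalizedMooreComplex.objX_zero]
    infer_instance
  exact ConcreteCategory.bijective_of_isIso (NormalizedMooreComplex.objX X 0).arrow

theorem exists_mooreInclusion_eq {n : ℕ} (x : X _⦋n + 1⦌)
    (hx : ∀ k : Fin (n + 1), face X k.succ x = 0) : ∃ a, mooreInclusion X (n + 1) a = x := by
  let K : Submodule R (X _⦋n + 1⦌) := ⨅ k : Fin (n + 1), LinearMap.ker (face X k.succ)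
  let h : ModuleCat.of R K ⟶ X _⦋n + 1⦌ := ModuleCat.ofHom K.subtype
  have hf : (NormalizedMooreComplex.objX X (n + 1)).Factors h := by
    refine (Subobject.finset_inf_factors _).2 fun k _ => ?_
    refine Limits.kernelSubobject_factors _ _ ?_
    ext y
    exact (Submodule.mem_iInf _).1 y.2 k
  exact ⟨Subobject.factorThru _ h hf ⟨x, (Submodule.mem_iInf _).2 hx⟩,
    ConcreteCategory.congr_hom (Subobject.factorThru_arrow _ h hf) _⟩

theorem face_succ_mooreInclusion {n : ℕ} (k : Fin (n + 1)) (a) :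
    face X k.succ (mooreInclusion X (n + 1) a) = 0 := by
  have h : (NormalizedMooreComplex.objX X (n + 1)).arrow ≫ X.δ k.succ = 0 := by
    have hf : (Limits.kernelSubobject (X.δ k.succ)).Factors
        (NormalizedMooreComplex.objX X (n + 1)).arrow :=
      Subobject.finset_inf_arrow_factors Finset.univ
        (fun k : Fin (n + 1) => Limits.kernelSubobject (X.δ k.succ)) k (Finset.mem_univ k)
    rw [← Subobject.factorThru_arrow _ _ hf, Category.assoc, Limits.kernelSubobject_arrow_comp,
      Limits.comp_zero]
  exact ConcreteCategory.congr_hom h a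

theorem face_zero_mooreInclusion (a) :
    face X (n := 0) 0 (mooreInclusion X 1 a) =
      mooreInclusion X 0 (((normalizedMooreComplex (ModuleCat.{u} R)).obj X).d 1 0 a) := by
  have h := normalizedMooreComplex_objD X 0
  have h' : NormalizedMooreComplex.objD X 0 ≫ (NormalizedMooreComplex.objX X 0).arrow =
      (NormalizedMooreComplex.objX X 1).arrow ≫ X.δ (0 : Fin 2) := by
    simp [NormalizedMooreComplex.objD]
  rw [← h] at h'
  exact (ConcreteCategory.congr_hom h' a).symm

theorem mooreInclusion_naturality {X Y : SimplicialObject (ModuleCat.{u} R)} (f : X ⟶ Y) (n : ℕ)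
    (a) : mooreInclusion Y n (((normalizedMooreComplex (ModuleCat.{u} R)).map f).f n a) =
      f.app (.op ⦋n⦌) (mooreInclusion X n a) :=
  ConcreteCategory.congr_hom (HomologicalComplex.congr_hom
    ((inclusionOfMooreComplex (ModuleCat.{u} R)).naturality f) n) a

theorem face_zero_mooreInclusion_map {K : ChainComplex (ModuleCat.{u} R) ℕ}
    (e : K ⟶ (normalizedMooreComplex (ModuleCat.{u} R)).obj X) (a : K.X 1) :
    face X (n := 0) 0 (mooreInclusion X 1 (e.f 1 a)) =
      mooreInclusion X 0 (e.f 0 (K.d 1 0 a)) :=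
  (face_zero_mooreInclusion X _).trans
    (congrArg (mooreInclusion X 0) (ConcreteCategory.congr_hom (e.comm 1 0) a))

theorem mooreInclusion_map_naturality {X Y : SimplicialObject (ModuleCat.{u} R)} {φ : X ⟶ Y}
    {K L : ChainComplex (ModuleCat.{u} R) ℕ} {f : K ⟶ L}
    {e : K ⟶ (normalizedMooreComplex (ModuleCat.{u} R)).obj X}
    {e' : L ⟶ (normalizedMooreComplex (ModuleCat.{u} R)).obj Y}
    (h : f ≫ e' = e ≫ (normalizedMooreComplex (ModuleCat.{u} R)).map φ) (n : ℕ) (a : K.X n) :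
    mooreInclusion Y n (e'.f n (f.f n a)) = φ.app (.op ⦋n⦌) (mooreInclusion X n (e.f n a)) :=
  (congrArg (mooreInclusion Y n)
    (ConcreteCategory.congr_hom (HomologicalComplex.congr_hom h n) a)).trans
      (mooreInclusion_naturality φ n _)

theorem eq_zero_of_face_eq_zero
    (h : Limits.IsZero (((normalizedMooreComplex (ModuleCat.{u} R)).obj X).X 2))
    (x : X _⦋2⦌) (h1 : face X (n := 1) 1 x = 0) (h2 : face X (n := 1) 2 x = 0) : x = 0 := by
  obtain ⟨a, rfl⟩ := exists_mooreInclusion_eq X (n := 1) x fun k => by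
    fin_cases k
    exacts [h1, h2]
  have := ModuleCat.subsingleton_of_isZero h
  rw [Subsingleton.elim a 0, map_zero]

end MooreComplex

section Resolution

open Simplicial AlgebraicTopology

variable {R : Type} [CommRing R] (A : ModuleCat.{u} R)

/-- The simplicial module corresponding to the canonical resolution of `A`. -/
def resolutionGamma : SimplicialObject (ModuleCat.{u} R) :=
  Abelian.DoldKan.Γ.obj ((freeResolution R).obj A)

/-- The map of simplicial modules induced by `f : A → B`. -/
def resolutionGammaMap {A B : ModuleCat.{u} R} (f : A ⟶ B) :
    resolutionGamma A ⟶ resolutionGamma B :=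
  Abelian.DoldKan.Γ.map ((freeResolution R).map f)

/-- The isomorphism of the canonical resolution with the normalized Moore complex of the
corresponding simplicial module, given by the Dold–Kan correspondence. -/
def resolutionMooreIso : (freeResolution R).obj A ≅
    (normalizedMooreComplex (ModuleCat.{u} R)).obj (resolutionGamma A) :=
  (Abelian.DoldKan.equivalence.counitIso.app ((freeResolution R).obj A)).symm

theorem resolutionMooreIso_naturality {A B : ModuleCat.{u} R} (f : A ⟶ B) :
    (freeResolution R).map f ≫ (resolutionMooreIso B).hom =
      (resolutionMooreIso A).hom ≫ (normalizedMooreComplex (ModuleCat.{u} R)).map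
        (resolutionGammaMap f) :=
  (Abelian.DoldKan.equivalence (A := ModuleCat.{u} R)).counitIso.inv.naturality
    ((freeResolution R).map f)

/-- The isomorphism `R[A] → Γ₀`. -/
def resolutionGammaZero : (A →₀ R) →ₗ[R] (resolutionGamma A) _⦋0⦌ :=
  mooreInclusion (resolutionGamma A) 0 ∘ₗ ((resolutionMooreIso A).hom.f 0).hom

/-- The isomorphism of `ker (R[A] → A)` with `ker (d₁ : Γ₁ → Γ₀)`. -/
def resolutionGammaOne : LinearMap.ker (freeCover A) →ₗ[R] (resolutionGamma A) _⦋1⦌ :=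
  mooreInclusion (resolutionGamma A) 1 ∘ₗ ((resolutionMooreIso A).hom.f 1).hom

theorem freeResolution_d (a : LinearMap.ker (freeCover A)) :
    ((freeResolution R).obj A).d 1 0 a = (a : A →₀ R) := by
  have h : ((freeResolution R).obj A).d 1 0 = freeResolutionD A 0 :=
    ChainComplex.of_d (freeResolutionX A) (freeResolutionD A) 0
  rw [h]
  rfl

theorem face_zero_resolutionGammaOne (a : LinearMap.ker (freeCover A)) :
    face (resolutionGamma A) (n := 0) 0 (resolutionGammaOne A a) = resolutionGammaZero A a := by
  refine (face_zero_mooreInclusion_map _ (resolutionMooreIso A).hom a).trans ?_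
  exact congrArg (resolutionGammaZero A) (freeResolution_d A a)

theorem face_one_resolutionGammaOne (a : LinearMap.ker (freeCover A)) :
    face (resolutionGamma A) (n := 0) 1 (resolutionGammaOne A a) = 0 :=
  face_succ_mooreInclusion _ (n := 0) 0 _

theorem resolutionMooreIso_bijective (n : ℕ) :
    Function.Bijective ((resolutionMooreIso A).hom.f n) :=
  ConcreteCategory.bijective_of_isIso ((resolutionMooreIso A).hom.f n)

theorem resolutionGammaZero_bijective : Function.Bijective (resolutionGammaZero A) :=
  (mooreInclusion_zero_bijective _).comp (resolutionMooreIso_bijective A 0)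

theorem resolutionGammaOne_injective : Function.Injective (resolutionGammaOne A) :=
  (mooreInclusion_injective _ 1).comp (resolutionMooreIso_bijective A 1).injective

theorem exists_resolutionGammaOne_eq (x : (resolutionGamma A) _⦋1⦌)
    (hx : face (resolutionGamma A) (n := 0) 1 x = 0) : ∃ a, resolutionGammaOne A a = x := by
  obtain ⟨b, rfl⟩ := exists_mooreInclusion_eq _ (n := 0) x fun k => by
    fin_cases k
    exact hx
  obtain ⟨a, rfl⟩ := (resolutionMooreIso_bijective A 1).surjective b
  exact ⟨a, rfl⟩

theorem resolutionGamma_eq_zero (x : (resolutionGamma A) _⦋2⦌)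
    (h1 : face (resolutionGamma A) (n := 1) 1 x = 0)
    (h2 : face (resolutionGamma A) (n := 1) 2 x = 0) : x = 0 := by
  refine eq_zero_of_face_eq_zero _ ?_ x h1 h2
  have h : Limits.IsZero (((freeResolution R).obj A).X 2) :=
    ModuleCat.isZero_of_subsingleton (ModuleCat.of R PUnit)
  exact h.of_iso ((HomologicalComplex.eval _ _ 2).mapIso (resolutionMooreIso A)).symm

/-- The Koszul-type complex of `ker (R[A] → A) ⊆ R[A]`. -/
abbrev resolutionKoszul : ShortComplex (ModuleCat.{u} R) :=
  koszul (A →₀ R) (LinearMap.ker (freeCover A))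

/-- The map of Koszul-type complexes of the canonical resolutions induced by `f : A → B`. -/
def resolutionKoszulMap {A B : ModuleCat.{u} R} (f : A ⟶ B) :
    resolutionKoszul A ⟶ resolutionKoszul B :=
  koszulMap (Finsupp.lmapDomain R R f) fun x hx => by
    rw [LinearMap.mem_ker] at hx
    rw [Submodule.mem_comap, LinearMap.mem_ker, freeCover_naturality, hx, map_zero]

/-- The comparison map from the Koszul-type complex of the canonical resolution. -/
def resolutionComparison : resolutionKoszul A ⟶ symSquareComplex (resolutionGamma A) :=
  koszulToSymSquare (resolutionGamma A) (resolutionGammaZero A) (resolutionGammaOne A)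
    (face_zero_resolutionGammaOne A) (face_one_resolutionGammaOne A)

instance : IsIso (ShortComplex.homologyMap (resolutionComparison A)) :=
  isIso_homologyMap_koszulToSymSquare _ _ _ _ _ (resolutionGamma_eq_zero A)
    (resolutionGammaZero_bijective A) (resolutionGammaOne_injective A)
    (exists_resolutionGammaOne_eq A)

theorem resolutionComparison_naturality {A B : ModuleCat.{u} R} (f : A ⟶ B) :
    resolutionComparison A ≫
        symSquareComplexMap (resolutionGammaMap f) =
      resolutionKoszulMap f ≫ resolutionComparison B := by
  exact koszulToSymSquare_naturality _ _ _ _ _ _ _ _ _ _ _ _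
    (mooreInclusion_map_naturality (resolutionMooreIso_naturality f) 0)
    (mooreInclusion_map_naturality (resolutionMooreIso_naturality f) 1)

theorem homologyMap_resolutionComparison_naturality {A B : ModuleCat.{u} R} (f : A ⟶ B) :
    ShortComplex.homologyMap (resolutionComparison A) ≫
        ShortComplex.homologyMap (symSquareComplexMap (resolutionGammaMap f)) =
      ShortComplex.homologyMap (resolutionKoszulMap f) ≫
        ShortComplex.homologyMap (resolutionComparison B) := by
  rw [← ShortComplex.homologyMap_comp, resolutionComparison_naturality,
    ShortComplex.homologyMap_comp]

/-- `L₁SP²(A)` is the homology of the Koszul-type complex of `ker (ℤ[A] → A) ⊆ ℤ[A]`. -/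
def resolutionKoszulHomologyIso (A : ModuleCat.{u} ℤ) :
    (resolutionKoszul A).homology ≅ L1SP2.obj A :=
  asIso (ShortComplex.homologyMap (resolutionComparison A)) ≪≫
    (HomologicalComplex.homologyFunctorIso' (ModuleCat.{u} ℤ)
      (ComplexShape.down ℕ) 2 1 0 (by simp) (by simp)).symm.app _

theorem resolutionKoszulHomologyIso_naturality {A B : ModuleCat.{u} ℤ} (f : A ⟶ B) :
    (resolutionKoszulHomologyIso A).hom ≫ L1SP2.map f =
      ShortComplex.homologyMap (resolutionKoszulMap f) ≫ (resolutionKoszulHomologyIso B).hom := by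
  have h := (HomologicalComplex.homologyFunctorIso' (ModuleCat.{u} ℤ)
    (ComplexShape.down ℕ) 2 1 0 (by simp) (by simp)).inv.naturality
      ((alternatingFaceMapComplex (ModuleCat.{u} ℤ)).map
        (((SimplicialObject.whiskering _ _).obj (SP2 ℤ)).map (resolutionGammaMap f)))
  refine (Category.assoc _ _ _).trans ?_
  refine (congrArg _ h.symm).trans ?_
  refine (Category.assoc _ _ _).symm.trans ?_
  refine (congrArg (· ≫ _) (homologyMap_resolutionComparison_naturality f)).trans ?_
  exact Category.assoc _ _ _

end Resolution

/-! ### Koszul-type complexes and quotients -/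

section Quotient

variable {R : Type} [CommRing R] {F E : Type u} [AddCommGroup F] [Module R F]
  [AddCommGroup E] [Module R E] {p : F →ₗ[R] E}

/-- The kernel of `SP²(F) → SP²(E)` is `ker p · F`. -/
theorem exists_koszulOne_eq_of_symPowerMap_eq_zero (hp : Function.Surjective p)
    {z : SymmetricPower R (Fin 2) F} (hz : symPowerMap 2 p z = 0) :
    ∃ v, koszulOne F (LinearMap.ker p) v = z := by
  let Q := LinearMap.range (koszulOne F (LinearMap.ker p))
  have hl : ∀ a b y, p a = p b → Q.mkQ (symMul R F a y) = Q.mkQ (symMul R F b y) := by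
    intro a b y h
    rw [← sub_eq_zero, ← map_sub, Submodule.mkQ_apply, Submodule.Quotient.mk_eq_zero,
      ← LinearMap.map_sub₂]
    exact ⟨⟨a - b, by rw [LinearMap.mem_ker, map_sub, h, sub_self]⟩ ⊗ₜ y, rfl⟩
  have hr : ∀ y a b, p a = p b → Q.mkQ (symMul R F y a) = Q.mkQ (symMul R F y b) := by
    intro y a b h
    rw [symMul_comm y, symMul_comm y, hl a b y h]
  let σ := Function.surjInv hp
  have hσ : ∀ x, p (σ x) = x := Function.surjInv_eq hp
  let β : E →ₗ[R] E →ₗ[R] (SymmetricPower R (Fin 2) F ⧸ Q) :=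
    LinearMap.mk₂ R (fun x y => Q.mkQ (symMul R F (σ x) (σ y)))
      (fun x x' y => by
        rw [hl (σ (x + x')) (σ x + σ x') _ (by simp [hσ]), map_add, LinearMap.add_apply, map_add])
      (fun c x y => by
        rw [hl (σ (c • x)) (c • σ x) _ (by simp [hσ]), map_smul, LinearMap.smul_apply, map_smul])
      (fun x y y' => by
        rw [hr _ (σ (y + y')) (σ y + σ y') (by simp [hσ]), map_add, map_add])
      (fun c x y => by
        rw [hr _ (σ (c • y)) (c • σ y) (by simp [hσ]), map_smul, map_smul])
  have hβ : ∀ x y, β x y = Q.mkQ (symMul R F (σ x) (σ y)) := fun _ _ => rfl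
  have hβs : ∀ x y, β x y = β y x := fun x y => by rw [hβ, hβ, symMul_comm]
  have h : symSquareLift β hβs (symPowerMap 2 p z) = Q.mkQ z :=
    symSquare_hom_ext (f := symSquareLift β hβs ∘ₗ symPowerMap 2 p) (g := Q.mkQ) (fun x y => by
      rw [LinearMap.comp_apply, symPowerMap_symMul, symSquareLift_symMul, hβ,
        hl (σ (p x)) x _ (hσ _), hr _ (σ (p y)) y (hσ _)]) z
  rw [hz, map_zero] at h
  exact (Submodule.Quotient.mk_eq_zero Q).1 h.symm

variable {S : Submodule R F} {I : Submodule R E}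

/-- The map `K ⊗ F → S ⊗ F` for `K ⊆ S ⊆ F`. -/
def tensorInclusion {K : Submodule R F} (h : K ≤ S.comap LinearMap.id) : K ⊗[R] F →ₗ[R] S ⊗[R] F :=
  TensorProduct.map (LinearMap.id.restrict h) LinearMap.id

theorem koszulOne_map_inclusion {K : Submodule R F} (h : K ≤ S.comap LinearMap.id)
    (v : K ⊗[R] F) : koszulOne F S (tensorInclusion h v) = koszulOne F K v :=
  LinearMap.congr_fun (f := koszulOne F S ∘ₗ tensorInclusion h)
    (g := koszulOne F K) (TensorProduct.ext' fun _ _ => rfl) v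

theorem map_map_inclusion_eq_zero (h : LinearMap.ker p ≤ S.comap LinearMap.id)
    (hpS : S ≤ I.comap p) (v : LinearMap.ker p ⊗[R] F) :
    TensorProduct.map (p.restrict hpS) p (tensorInclusion h v) = 0 := by
  refine LinearMap.congr_fun (f := TensorProduct.map (p.restrict hpS) p ∘ₗ tensorInclusion h)
    (g := 0) (TensorProduct.ext' fun a x => ?_) v
  have : p.restrict hpS (LinearMap.id.restrict h a) = 0 := Subtype.ext a.2
  rw [LinearMap.comp_apply, tensorInclusion, TensorProduct.map_tmul, TensorProduct.map_tmul, this,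
    TensorProduct.zero_tmul, LinearMap.zero_apply]

theorem restrict_surjective (hp : Function.Surjective p) (hpS : S ≤ I.comap p)
    (hS : I.comap p ≤ S) : Function.Surjective (p.restrict hpS) := by
  rintro ⟨y, hy⟩
  obtain ⟨x, rfl⟩ := hp y
  exact ⟨⟨x, hS hy⟩, rfl⟩

theorem epi_homologyMap_koszulMap (hp : Function.Surjective p) (hpS : S ≤ I.comap p)
    (hS : I.comap p ≤ S) : Epi (ShortComplex.homologyMap (koszulMap p hpS)) := by
  have hK : LinearMap.ker p ≤ S.comap LinearMap.id := fun x hx =>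
    hS (by rw [Submodule.mem_comap, hx]; exact I.zero_mem)
  refine epi_homologyMap _ fun y hy => ?_
  obtain ⟨t, rfl⟩ := TensorProduct.map_surjective (restrict_surjective hp hpS hS) hp y
  have ht : symPowerMap 2 p (koszulOne F S t) = 0 :=
    (ConcreteCategory.congr_hom (koszulMap p hpS).comm₂₃ t).symm.trans hy
  obtain ⟨v, hv⟩ := exists_koszulOne_eq_of_symPowerMap_eq_zero hp ht
  refine ⟨t - tensorInclusion hK v, ?_, 0, ?_⟩
  · change koszulOne F S _ = 0
    rw [map_sub, koszulOne_map_inclusion, hv, sub_self]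
  · change koszulTwo E I 0 = TensorProduct.map (p.restrict hpS) p _ -
      TensorProduct.map (p.restrict hpS) p t
    rw [map_sub, map_map_inclusion_eq_zero, map_zero, sub_zero, sub_self]

/-- Modulo the image of `Λ²(S)`, the elements of `ker (S ⊗ F → I ⊗ E)` come from `ker p ⊗ F`:
an element `s ⊗ k` with `k ∈ ker p` may be replaced by `k ⊗ s`. -/
theorem exists_map_inclusion_sub_eq (hp : Function.Surjective p) (hpS : S ≤ I.comap p)
    (hS : I.comap p ≤ S) (hK : LinearMap.ker p ≤ S.comap LinearMap.id) {t : S ⊗[R] F}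
    (ht : TensorProduct.map (p.restrict hpS) p t = 0) :
    ∃ v w, koszulTwo F S w = tensorInclusion hK v - t := by
  let P : Submodule R (S ⊗[R] F) :=
    LinearMap.range (tensorInclusion hK) ⊔ LinearMap.range (koszulTwo F S)
  suffices h : t ∈ P by
    obtain ⟨_, ⟨v, rfl⟩, _, ⟨w, rfl⟩, h⟩ := Submodule.mem_sup.1 h
    exact ⟨v, -w, by rw [← h, map_neg]; abel⟩
  have hker : ∀ (s : S) (k : F), p s = 0 → s ⊗ₜ[R] k ∈ P := fun s k hs =>
    Submodule.mem_sup_left ⟨(⟨s, hs⟩ : LinearMap.ker p) ⊗ₜ k, rfl⟩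
  have hker' : ∀ (s : S) (k : F), p k = 0 → s ⊗ₜ[R] k ∈ P := fun s k hk => by
    have h1 : koszulTwo F S (exteriorPower.ιMulti R 2 ![s, ⟨k, hK hk⟩]) ∈ P :=
      Submodule.mem_sup_right ⟨_, rfl⟩
    rw [koszulTwo_ιMulti] at h1
    have h2 := add_mem h1 (hker ⟨k, hK hk⟩ s hk)
    simpa using h2
  have hex1 : Function.Exact (LinearMap.ker (p.restrict hpS)).subtype (p.restrict hpS) :=
    LinearMap.exact_subtype_ker_map _
  have hex2 : Function.Exact (LinearMap.ker p).subtype p := LinearMap.exact_subtype_ker_map _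
  have hmem : t ∈ LinearMap.ker (TensorProduct.map (p.restrict hpS) p) := ht
  rw [TensorProduct.map_ker hex1 (restrict_surjective hp hpS hS) hex2 hp] at hmem
  refine (sup_le ?_ ?_ : _ ≤ P) hmem
  · rintro _ ⟨b, rfl⟩
    induction b with
    | zero => rw [map_zero]; exact zero_mem _
    | add x y hx hy => rw [map_add]; exact add_mem hx hy
    | tmul s k => exact hker' s k k.2
  · rintro _ ⟨b, rfl⟩
    induction b with
    | zero => rw [map_zero]; exact zero_mem _
    | add x y hx hy => rw [map_add]; exact add_mem hx hy
    | tmul s k => exact hker s.1 k (congrArg Subtype.val s.2)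

/-- The homology of the Koszul-type complexes of `ker p ⊆ F`, `S = p⁻¹(I) ⊆ F` and `I ⊆ E` forms
a sequence which is exact in the middle. -/
theorem exists_homologyMap_koszulMap_id_eq (hp : Function.Surjective p) (hpS : S ≤ I.comap p)
    (hS : I.comap p ≤ S) (hK : LinearMap.ker p ≤ S.comap LinearMap.id)
    (c : (koszul F S).homology) (hc : ShortComplex.homologyMap (koszulMap p hpS) c = 0) :
    ∃ b, ShortComplex.homologyMap (koszulMap (LinearMap.id : F →ₗ[R] F) hK) b = c := by
  refine exists_homologyMap_eq _ (koszulMap p hpS) (fun (y : S ⊗[R] F) hy ⟨z, hz⟩ => ?_) c hc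
  obtain ⟨z', rfl⟩ := exteriorPower.map_surjective (n := 2) (restrict_surjective hp hpS hS) z
  have hz' : TensorProduct.map (p.restrict hpS) p (y - koszulTwo F S z') = 0 := by
    have h := ConcreteCategory.congr_hom (koszulMap p hpS).comm₁₂ z'
    rw [map_sub, sub_eq_zero]
    exact hz.symm.trans h
  obtain ⟨v, w, hw⟩ := exists_map_inclusion_sub_eq hp hpS hS hK hz'
  have hw' : koszulTwo F S (w - z') =
      tensorInclusion hK v - y := by
    rw [map_sub, hw]
    abel
  refine ⟨v, ?_, w - z', hw'⟩
  have h : (koszul F S).g (tensorInclusion hK v) = 0 :=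
    g_eq_zero_of_f_eq_sub (S := koszul F S) hw' hy
  exact (koszulOne_map_inclusion hK v).symm.trans h

/-- The composite `H(ker p ⊆ F) → H(S ⊆ F) → H(I ⊆ E)` vanishes. -/
theorem homologyMap_koszulMap_id_comp (hpS : S ≤ I.comap p)
    (hK : LinearMap.ker p ≤ S.comap LinearMap.id) :
    ShortComplex.homologyMap (koszulMap (LinearMap.id : F →ₗ[R] F) hK) ≫
      ShortComplex.homologyMap (koszulMap p hpS) = 0 := by
  ext b
  obtain ⟨v, hv, rfl⟩ := exists_homologyClass_eq b
  refine (congrArg _ (homologyMap_homologyClass _ _ _)).trans ?_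
  refine (homologyMap_homologyClass _ _ _).trans ?_
  refine homologyClass_eq_zero_iff.2 ⟨0, ?_⟩
  exact (map_zero (koszul E I).f.hom).trans (map_map_inclusion_eq_zero hK hpS v).symm

/-- If `K` is a direct summand of `F`, the Koszul-type complex of `K ⊆ F` is exact in the middle.
With a retraction `r` onto `K`, the map `x y ↦ r x ⊗ y + r y ⊗ (x - r x)` is an inverse of
`K ⊗ F → SP²(F)` modulo the image of `Λ²(K)`. -/
theorem exists_koszulTwo_eq_of_retraction {K : Submodule R F} (r : F →ₗ[R] K)
    (hr : ∀ k : K, r k = k) {t : K ⊗[R] F} (ht : koszulOne F K t = 0) :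
    ∃ w, koszulTwo F K w = t := by
  let Q := LinearMap.range (koszulTwo F K)
  let β : F →ₗ[R] F →ₗ[R] (K ⊗[R] F ⧸ Q) :=
    ((TensorProduct.mk R K F).compl₁₂ r LinearMap.id +
      ((TensorProduct.mk R K F).compl₁₂ r (LinearMap.id - K.subtype ∘ₗ r)).flip).compr₂ Q.mkQ
  have hβ : ∀ x y, β x y = Q.mkQ (r x ⊗ₜ y + r y ⊗ₜ (x - (r x : F))) := fun _ _ => rfl
  have hβs : ∀ x y, β x y = β y x := by
    intro x y
    have h : Q.mkQ (r x ⊗ₜ (r y : F) - r y ⊗ₜ (r x : F)) = 0 :=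
      (Submodule.Quotient.mk_eq_zero Q).2
        ⟨exteriorPower.ιMulti R 2 ![r x, r y], koszulTwo_ιMulti F K _⟩
    rw [hβ, hβ, ← sub_eq_zero, ← map_sub, ← h]
    congr 1
    simp only [TensorProduct.tmul_sub]
    abel
  have h : symSquareLift β hβs (koszulOne F K t) = Q.mkQ t := by
    refine LinearMap.congr_fun (f := symSquareLift β hβs ∘ₗ koszulOne F K) (g := Q.mkQ)
      (TensorProduct.ext' fun k x => ?_) t
    rw [LinearMap.comp_apply]
    refine (symSquareLift_symMul β hβs (k : F) x).trans ?_
    rw [hβ, hr, sub_self, TensorProduct.tmul_zero, add_zero]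
  rw [ht, map_zero] at h
  exact (Submodule.Quotient.mk_eq_zero Q).1 h.symm

/-- If `p : F → E` is a split surjection and `S = p⁻¹(I)`, the Koszul-type complexes of `S ⊆ F` and
`I ⊆ E` have the same homology in the middle. -/
theorem isIso_homologyMap_koszulMap_of_section {σ : E →ₗ[R] F} (hσ : ∀ x, p (σ x) = x)
    (hpS : S ≤ I.comap p) (hS : I.comap p ≤ S) :
    IsIso (ShortComplex.homologyMap (koszulMap p hpS)) := by
  have hp : Function.Surjective p := fun x => ⟨σ x, hσ x⟩
  have hK : LinearMap.ker p ≤ S.comap LinearMap.id := fun x hx =>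
    hS (by rw [Submodule.mem_comap, hx]; exact I.zero_mem)
  have := epi_homologyMap_koszulMap hp hpS hS
  have : Mono (ShortComplex.homologyMap (koszulMap p hpS)) := by
    rw [ModuleCat.mono_iff_injective]
    refine (injective_iff_map_eq_zero (ShortComplex.homologyMap (koszulMap p hpS)).hom).2
      fun c hc => ?_
    obtain ⟨b, rfl⟩ := exists_homologyMap_koszulMap_id_eq hp hpS hS hK c hc
    obtain ⟨t, ht, rfl⟩ := exists_homologyClass_eq b
    let r : F →ₗ[R] LinearMap.ker p := (LinearMap.id - σ ∘ₗ p).codRestrict _ fun x => by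
      simp [hσ]
    have hr : ∀ k : LinearMap.ker p, r k = k := fun k => Subtype.ext (by
      simp [r])
    have h0 : homologyClass (koszul F (LinearMap.ker p)) t ht = 0 :=
      homologyClass_eq_zero_iff.2 (exists_koszulTwo_eq_of_retraction r hr ht)
    rw [h0, map_zero]
  exact isIso_of_mono_of_epi _

end Quotient

/-! ### The presentation of the homology of the Koszul-type complex -/

section Presentation

variable {R : Type} [CommRing R]

section Comp

variable {E E' E'' : Type u} [AddCommGroup E] [Module R E] [AddCommGroup E'] [Module R E']
  [AddCommGroup E''] [Module R E''] {I : Submodule R E} {I' : Submodule R E'}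
  {I'' : Submodule R E''}

theorem koszulMap_comp (f : E →ₗ[R] E') (hf : I ≤ I'.comap f) (g : E' →ₗ[R] E'')
    (hg : I' ≤ I''.comap g) (h : E →ₗ[R] E'') (hh : I ≤ I''.comap h) (hfg : ∀ x, g (f x) = h x) :
    koszulMap f hf ≫ koszulMap g hg = koszulMap h hh := by
  obtain rfl : g ∘ₗ f = h := LinearMap.ext hfg
  apply ShortComplex.hom_ext
  · ext1
    refine exteriorPower.linearMap_ext ?_
    ext v
    change exteriorPower.map 2 _ (exteriorPower.map 2 _ (exteriorPower.ιMulti R 2 v)) =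
      exteriorPower.map 2 _ (exteriorPower.ιMulti R 2 v)
    simp only [exteriorPower.map_apply_ιMulti]
    rfl
  · ext1
    exact TensorProduct.ext' fun _ _ => rfl
  · exact ((SP2 R).map_comp (ModuleCat.ofHom f) (ModuleCat.ofHom g)).symm

theorem homologyMap_koszulMap_comp (f : E →ₗ[R] E') (hf : I ≤ I'.comap f) (g : E' →ₗ[R] E'')
    (hg : I' ≤ I''.comap g) (h : E →ₗ[R] E'') (hh : I ≤ I''.comap h) (hfg : ∀ x, g (f x) = h x) :
    ShortComplex.homologyMap (koszulMap f hf) ≫ ShortComplex.homologyMap (koszulMap g hg) =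
      ShortComplex.homologyMap (koszulMap h hh) := by
  rw [← ShortComplex.homologyMap_comp, koszulMap_comp f hf g hg h hh hfg]

end Comp

variable (E : Type u) [AddCommGroup E] [Module R E] (I : Submodule R E)

/-- The inverse image of `I` in the free module `R[E]`. -/
abbrev freeComap : Submodule R (ModuleCat.of R E →₀ R) := I.comap (freeCover (ModuleCat.of R E))

theorem freeComap_eq : freeComap E I =
    (LinearMap.ker (freeCover (ModuleCat.of R (E ⧸ I)))).comap
      (Finsupp.lmapDomain R R (ModuleCat.ofHom I.mkQ)) := by
  ext x
  have h : freeCover (ModuleCat.of R (E ⧸ I))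
      (Finsupp.lmapDomain R R (ModuleCat.ofHom I.mkQ) x) =
        I.mkQ (freeCover (ModuleCat.of R E) x) :=
    freeCover_naturality (ModuleCat.ofHom I.mkQ) x
  rw [Submodule.mem_comap, Submodule.mem_comap, LinearMap.mem_ker, h]
  exact (Submodule.Quotient.mk_eq_zero I).symm

theorem ker_freeCover_le_freeComap : LinearMap.ker (freeCover (ModuleCat.of R E)) ≤
    (freeComap E I).comap LinearMap.id := fun x hx => by
  change freeCover (ModuleCat.of R E) x ∈ I
  rw [LinearMap.mem_ker.1 hx]
  exact I.zero_mem

/-- The map from the homology of `freeComap E I ⊆ R[E]` to that of the canonical resolution of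
`E ⧸ I`. -/
def freeComapToResolution : (koszul _ (freeComap E I)).homology ⟶
    (resolutionKoszul (ModuleCat.of R (E ⧸ I))).homology :=
  ShortComplex.homologyMap (koszulMap (Finsupp.lmapDomain R R (ModuleCat.ofHom I.mkQ))
    (freeComap_eq E I).le)

/-- The map from the homology of `freeComap E I ⊆ R[E]` to that of `I ⊆ E`. -/
def freeComapToKoszul : (koszul _ (freeComap E I)).homology ⟶ (koszul E I).homology :=
  ShortComplex.homologyMap (koszulMap (freeCover (ModuleCat.of R E)) le_rfl)

/-- The map from the homology of the canonical resolution of `E` to that of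
`freeComap E I ⊆ R[E]`. -/
def resolutionToFreeComap : (resolutionKoszul (ModuleCat.of R E)).homology ⟶
    (koszul _ (freeComap E I)).homology :=
  ShortComplex.homologyMap (koszulMap LinearMap.id (ker_freeCover_le_freeComap E I))

instance : IsIso (freeComapToResolution E I) := by
  let q : ModuleCat.of R E → ModuleCat.of R (E ⧸ I) := ModuleCat.ofHom I.mkQ
  have hq : Function.Surjective q := I.mkQ_surjective
  refine isIso_homologyMap_koszulMap_of_section
    (σ := Finsupp.lmapDomain R R (Function.surjInv hq)) (fun x => ?_) _ (freeComap_eq E I).ge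
  refine (Finsupp.mapDomain_comp (f := Function.surjInv hq) (g := q)).symm.trans ?_
  rw [(Function.rightInverse_surjInv hq).comp_eq_id, Finsupp.mapDomain_id]

instance : Epi (freeComapToKoszul E I) :=
  epi_homologyMap_koszulMap (freeCover_surjective _) _ le_rfl

theorem resolutionToFreeComap_comp : resolutionToFreeComap E I ≫ freeComapToResolution E I =
    ShortComplex.homologyMap (resolutionKoszulMap (ModuleCat.ofHom I.mkQ)) :=
  homologyMap_koszulMap_comp _ _ _ _ _ _ fun _ => rfl

/-- The sequence `H(ker (R[E] → E) ⊆ R[E]) → H(freeComap E I ⊆ R[E]) → H(I ⊆ E)`. -/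
def freeComapSequence : ShortComplex (ModuleCat.{u} R) :=
  ShortComplex.mk (resolutionToFreeComap E I) (freeComapToKoszul E I)
    (homologyMap_koszulMap_id_comp _ _)

theorem freeComapSequence_exact : (freeComapSequence E I).Exact :=
  (ShortComplex.moduleCat_exact_iff _).2 fun c hc =>
    exists_homologyMap_koszulMap_id_eq (freeCover_surjective _) le_rfl le_rfl _ c hc

variable {E I} {E' : Type u} [AddCommGroup E'] [Module R E'] {I' : Submodule R E'}
  (f : E →ₗ[R] E') (hf : I ≤ I'.comap f)

include hf in
theorem freeComap_le : freeComap E I ≤ (freeComap E' I').comap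
    (Finsupp.lmapDomain R R (ModuleCat.ofHom f)) := fun x hx => by
  change freeCover (ModuleCat.of R E') _ ∈ I'
  have h := freeCover_naturality (ModuleCat.ofHom f) x
  rw [h]
  exact hf hx

/-- The map `H(freeComap E I ⊆ R[E]) → H(freeComap E' I' ⊆ R[E'])` induced by `f`. -/
def freeComapMap : (koszul _ (freeComap E I)).homology ⟶ (koszul _ (freeComap E' I')).homology :=
  ShortComplex.homologyMap (koszulMap (Finsupp.lmapDomain R R (ModuleCat.ofHom f))
    (freeComap_le f hf))

theorem freeComapToKoszul_naturality : freeComapMap f hf ≫ freeComapToKoszul E' I' =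
    freeComapToKoszul E I ≫ ShortComplex.homologyMap (koszulMap f hf) := by
  have h : freeComap E I ≤ I'.comap (f ∘ₗ freeCover (ModuleCat.of R E)) := fun x hx => hf hx
  exact (homologyMap_koszulMap_comp _ _ _ _ _ h
    (fun x => freeCover_naturality (ModuleCat.ofHom f) x)).trans
    (homologyMap_koszulMap_comp _ _ _ _ _ h fun _ => rfl).symm

theorem freeComapToResolution_naturality : freeComapMap f hf ≫ freeComapToResolution E' I' =
    freeComapToResolution E I ≫ ShortComplex.homologyMap
      (resolutionKoszulMap (ModuleCat.ofHom (I.mapQ I' f hf))) := by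
  have hfun : ∀ x : ModuleCat.of R E →₀ R,
      Finsupp.lmapDomain R R (ModuleCat.ofHom I'.mkQ)
        (Finsupp.lmapDomain R R (ModuleCat.ofHom f) x) =
      Finsupp.lmapDomain R R (ModuleCat.ofHom (I.mapQ I' f hf))
        (Finsupp.lmapDomain R R (ModuleCat.ofHom I.mkQ) x) := fun x =>
    Finsupp.mapDomain_comp.symm.trans (Finsupp.mapDomain_comp (v := x)
      (f := (ModuleCat.ofHom I.mkQ : ModuleCat.of R E → ModuleCat.of R (E ⧸ I)))
      (g := (ModuleCat.ofHom (I.mapQ I' f hf) :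
        ModuleCat.of R (E ⧸ I) → ModuleCat.of R (E' ⧸ I'))))
  have h : freeComap E I ≤ (LinearMap.ker (freeCover (ModuleCat.of R (E' ⧸ I')))).comap
      (Finsupp.lmapDomain R R (ModuleCat.ofHom I'.mkQ) ∘ₗ
        Finsupp.lmapDomain R R (ModuleCat.ofHom f)) := fun x hx =>
    (freeComap_eq E' I').le (freeComap_le f hf hx)
  exact (homologyMap_koszulMap_comp _ _ _ _ _ h fun _ => rfl).trans
    (homologyMap_koszulMap_comp _ _ _ _ _ h fun x => (hfun x).symm).symm

end Presentation

/-! ### The cokernel of `L₁SP²(E) → L₁SP²(E/I)` -/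

section Main

variable (E : Type u) [AddCommGroup E] (I : Submodule ℤ E)

/-- `L₁SP²(E/I)` is the homology of the Koszul-type complex of `freeComap E I ⊆ ℤ[E]`. -/
def freeComapIso : (koszul _ (freeComap E I)).homology ≅ L1SP2.obj (ModuleCat.of ℤ (E ⧸ I)) :=
  asIso (freeComapToResolution E I) ≪≫ resolutionKoszulHomologyIso (ModuleCat.of ℤ (E ⧸ I))

theorem resolutionToFreeComap_freeComapIso :
    (resolutionKoszulHomologyIso (ModuleCat.of ℤ E)).hom ≫ L1SP2.map (ModuleCat.ofHom I.mkQ) =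
      resolutionToFreeComap E I ≫ (freeComapIso E I).hom := by
  rw [resolutionKoszulHomologyIso_naturality, ← resolutionToFreeComap_comp, Category.assoc]
  rfl

/-- The map `L₁SP²(E/I) → H(I ⊆ E)`. -/
def derivedToKoszul : L1SP2.obj (ModuleCat.of ℤ (E ⧸ I)) ⟶ (koszul E I).homology :=
  (freeComapIso E I).inv ≫ freeComapToKoszul E I

instance : Epi (derivedToKoszul E I) := epi_comp _ _

theorem map_derivedToKoszul : L1SP2.map (ModuleCat.ofHom I.mkQ) ≫ derivedToKoszul E I = 0 := by
  rw [← cancel_epi (resolutionKoszulHomologyIso (ModuleCat.of ℤ E)).hom, derivedToKoszul,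
    ← Category.assoc, resolutionToFreeComap_freeComapIso, Category.assoc,
    Iso.hom_inv_id_assoc, Limits.comp_zero]
  exact (freeComapSequence E I).zero

/-- The sequence `L₁SP²(E) → L₁SP²(E/I) → H(I ⊆ E)`. -/
def derivedSequence : ShortComplex (ModuleCat.{u} ℤ) :=
  ShortComplex.mk (L1SP2.map (ModuleCat.ofHom I.mkQ)) (derivedToKoszul E I)
    (map_derivedToKoszul E I)

theorem derivedSequence_exact : (derivedSequence E I).Exact := by
  refine ShortComplex.exact_of_iso (?_ : freeComapSequence E I ≅ derivedSequence E I)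
    (freeComapSequence_exact E I)
  refine ShortComplex.isoMk (resolutionKoszulHomologyIso (ModuleCat.of ℤ E)) (freeComapIso E I)
    (Iso.refl _) (resolutionToFreeComap_freeComapIso E I) ?_
  change (freeComapIso E I).hom ≫ (freeComapIso E I).inv ≫ freeComapToKoszul E I =
    freeComapToKoszul E I ≫ 𝟙 _
  rw [Iso.hom_inv_id_assoc, Category.comp_id]

/-- The projection of `L₁SP²(E/I)` onto `Coker {L₁SP²(E) → L₁SP²(E/I)}`. -/
def cokerL1SP2π : L1SP2.obj (ModuleCat.of ℤ (E ⧸ I)) ⟶ cokerL1SP2 E I :=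
  Limits.cokernel.π (L1SP2.map (ModuleCat.ofHom I.mkQ))

instance : Epi (cokerL1SP2π E I) :=
  inferInstanceAs (Epi (Limits.cokernel.π (L1SP2.map (ModuleCat.ofHom I.mkQ))))

/-- The map `Coker {L₁SP²(E) → L₁SP²(E/I)} → H(I ⊆ E)`. -/
def cokerL1SP2ToKoszul : cokerL1SP2 E I ⟶ (koszul E I).homology :=
  Limits.cokernel.desc _ (derivedToKoszul E I) (map_derivedToKoszul E I)

theorem cokerL1SP2π_cokerL1SP2ToKoszul :
    cokerL1SP2π E I ≫ cokerL1SP2ToKoszul E I = derivedToKoszul E I :=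
  Limits.cokernel.π_desc _ _ _

instance : IsIso (cokerL1SP2ToKoszul E I) := by
  have : Mono (cokerL1SP2ToKoszul E I) :=
    (derivedSequence E I).exact_iff_mono_cokernel_desc.1 (derivedSequence_exact E I)
  have : Epi (cokerL1SP2ToKoszul E I) := epi_of_epi_fac (cokerL1SP2π_cokerL1SP2ToKoszul E I)
  exact isIso_of_mono_of_epi _

variable {E I} {E' : Type u} [AddCommGroup E'] {I' : Submodule ℤ E'}
  (f : E →ₗ[ℤ] E') (hf : I ≤ I'.comap f)

theorem freeComapIso_naturality :
    (freeComapIso E I).hom ≫ L1SP2.map (ModuleCat.ofHom (I.mapQ I' f hf)) =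
      freeComapMap f hf ≫ (freeComapIso E' I').hom := by
  change (freeComapToResolution E I ≫ _) ≫ _ = _ ≫ freeComapToResolution E' I' ≫ _
  rw [Category.assoc, resolutionKoszulHomologyIso_naturality, ← Category.assoc,
    ← freeComapToResolution_naturality, Category.assoc]

theorem derivedToKoszul_naturality :
    L1SP2.map (ModuleCat.ofHom (I.mapQ I' f hf)) ≫ derivedToKoszul E' I' =
      derivedToKoszul E I ≫ ShortComplex.homologyMap (koszulMap f hf) := by
  rw [← cancel_epi (freeComapIso E I).hom, derivedToKoszul, derivedToKoszul, ← Category.assoc,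
    freeComapIso_naturality, Category.assoc, Iso.hom_inv_id_assoc, Category.assoc,
    Iso.hom_inv_id_assoc, freeComapToKoszul_naturality]

theorem cokerL1SP2π_cokerL1SP2Map : cokerL1SP2π E I ≫ cokerL1SP2Map f hf =
    L1SP2.map (ModuleCat.ofHom (I.mapQ I' f hf)) ≫ cokerL1SP2π E' I' :=
  Limits.cokernel.π_desc _ _ _

theorem cokerL1SP2ToKoszul_naturality :
    cokerL1SP2Map f hf ≫ cokerL1SP2ToKoszul E' I' =
      cokerL1SP2ToKoszul E I ≫ ShortComplex.homologyMap (koszulMap f hf) := by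
  rw [← cancel_epi (cokerL1SP2π E I), ← Category.assoc, ← Category.assoc,
    cokerL1SP2π_cokerL1SP2ToKoszul, cokerL1SP2π_cokerL1SP2Map, Category.assoc,
    cokerL1SP2π_cokerL1SP2ToKoszul, derivedToKoszul_naturality]

end Main

end

theorem theorem3p1 :
    ∃ φ : ∀ (E : Type u) [AddCommGroup E] (I : Submodule ℤ E),
        (koszul E I).homology ≅ cokerL1SP2 E I,
      ∀ (E E' : Type u) [AddCommGroup E] [AddCommGroup E'] (I : Submodule ℤ E)
        (I' : Submodule ℤ E') (f : E →ₗ[ℤ] E') (hf : I ≤ I'.comap f),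
        (φ E I).hom ≫ cokerL1SP2Map f hf =
          ShortComplex.homologyMap (koszulMap f hf) ≫ (φ E' I').hom := by
  refine ⟨fun E _ I => (asIso (cokerL1SP2ToKoszul E I)).symm, ?_⟩
  intro E E' _ _ I I' f hf
  change inv (cokerL1SP2ToKoszul E I) ≫ _ = _ ≫ inv (cokerL1SP2ToKoszul E' I')
  rw [IsIso.inv_comp_eq, ← Category.assoc, ← cokerL1SP2ToKoszul_naturality, Category.assoc,
    IsIso.hom_inv_id, Category.comp_id]
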